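/- Let $n\ge 1$, let $\mathbb{Z}[q]=\mathbb{Z}[q_1,\dots,q_{n-1}]$ and $R=\mathbb{Z}[(1-q_1)^{\pm1},\dots,(1-q_{n-1})^{\pm1}]\supset\mathbb{Z}[q]$. Let $L_n$ be the $\mathbb{Z}$-span of the monomials $x_1^{i_1}\cdots x_{n-1}^{i_{n-1}}$ with $0\le i_j\le n-j$, let $L_n^q=\mathbb{Z}[q]\otimes L_n$, and regard $R\otimes L_n$ as the $R$-span of the same monomials in $R[x_1,\dots,x_n]$. For $0\le p\le k\le n-1$ let $e_p^k=e_p(x_1,\dots,x_k)$ be the elementary symmetric polynomial, and put $$F_p^k=\sum_{I\subseteq\{1,\dots,k\},\,|I|=p}\ \prod_{i\in I}(1-x_i)\prod_{i\in I,\ i+1\notin I}(1-q_i)\quad(F_0^k=1),\qquad \widehat E_p^k=\sum_{i=0}^p(-1)^i\binom{k-i}{p-i}F_i^k .$$ For a doubly indexed family $a_p^k$ write $a_{p_1\ldots p_{n-1}}=a_{p_1}^1a_{p_2}^2\cdots a_{p_{n-1}}^{n-1}$, where $0\le p_i\le i$. The products $e_{p_1\ldots p_{n-1}}$ form a $\mathbb{Z}$-basis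 of $L_n$; let $\widehat Q:L_n^q\to L_n^q$ be the $\mathbb{Z}[q]$-linear map with $\widehat Q(e_{p_1\ldots p_{n-1}})=\widehat E_{p_1\ldots p_{n-1}}$. For $w\in S_n$ let $\mathfrak G_w\in L_n$ be the Grothendieck polynomial: $\mathfrak G_{w_\circ}=x_1^{n-1}x_2^{n-2}\cdots x_{n-1}$ for the longest permutation $w_\circ$, and $\mathfrak G_w=\pi_i\,\mathfrak G_{ws_i}$ whenever $w(i)<w(i+1)$, where $s_i$ is the transposition of $i$ and $i+1$ and $\pi_i f=f+(1-x_i)\frac{f-s_if}{x_i-x_{i+1}}$. The quantum Grothendieck polynomial is $\mathfrak G_w^q=\widehat Q(\mathfrak G_w)$. Finally let $G_0^k=1$ and, for $1\le p\le k\le n-1$, let $G_p^k=\mathfrak G^q_{c[k,p]}$, where $c[k,p]\in S_n$ is the cycle $(k-p+1,k-p+2,\dots,k+1)$. Then each of the four families $$\{F_{p_1\ldots p_{n-1}}: 0\le p_i\le i\},\quad \{\mathfrak G_w^q: w\in S_n\},\quad \{\widehat E_{p_1\ldots p_{n-1}}: 0\le p_i\le i\},\quad \{G_{p_1\ldots p_{n-1}}: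 0\le p_i\le i\}$$ is an $R$-linear basis of the module $R\otimes L_n$. -/

import Mathlib

open scoped BigOperators

namespace QGroth

noncomputable section

open MvPolynomial

/-! Variables are numbered from `1` in the formulas below: `xv A n i` is `x_i` for `1 ≤ i ≤ n`, and
`qv n i` is `q_i` for `1 ≤ i ≤ n - 1`. The values outside these ranges are never used. -/

/-- The ring `ℤ[q] = ℤ[q_1, …, q_{n-1}]`. -/
abbrev QRing (n : ℕ) : Type := MvPolynomial (Fin (n - 1)) ℤ

/-- The variable `q_i` of `ℤ[q]`. -/
def qv (n i : ℕ) : QRing n :=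
  if h : 1 ≤ i ∧ i ≤ n - 1 then X ⟨i - 1, by omega⟩ else 0

/-- The variable `x_i` of `A[x] = A[x_1, …, x_n]`. -/
def xv (A : Type) [CommRing A] (n i : ℕ) : MvPolynomial (Fin n) A :=
  if h : 1 ≤ i ∧ i ≤ n then X ⟨i - 1, by omega⟩ else 0

/-- The ring `R = ℤ[(1 - q_1)^{±1}, …, (1 - q_{n-1})^{±1}]`, that is, `ℤ[q]` with all the elements
`1 - q_i` inverted. -/
abbrev R (n : ℕ) : Type :=
  Localization (Submonoid.closure (Set.range fun i : Fin (n - 1) => (1 - X i : QRing n)))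

/-- For a coefficient ring `A`, the module `A ⊗ L_n`, as the `A`-submodule of `A[x_1, …, x_n]`
spanned by the monomials `x_1^{i_1} ⋯ x_n^{i_n}` with `0 ≤ i_j ≤ n - j` (so that `i_n = 0`).
In the zero-based numbering of `Fin n` the bound reads `a j ≤ n - (j + 1)`. -/
def L (A : Type) [CommRing A] (n : ℕ) : Submodule A (MvPolynomial (Fin n) A) :=
  Submodule.span A
    {f | ∃ a : Fin n →₀ ℕ, (∀ j : Fin n, a j ≤ n - ((j : ℕ) + 1)) ∧ f = monomial a 1}

/-- The index sequences `(p_1, …, p_{n-1})` with `0 ≤ p_i ≤ i`; the entry at `i : Fin (n - 1)` is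
`p_{i+1}`. -/
abbrev Idx (n : ℕ) : Type := (i : Fin (n - 1)) → Fin ((i : ℕ) + 2)

/-! ### Elementary polynomials and their quantum `K`-theoretic analogues -/

/-- The elementary symmetric polynomial `e_p^k = e_p(x_1, …, x_k)`, in `ℤ[q][x]`. -/
def e (n k p : ℕ) : MvPolynomial (Fin n) (QRing n) :=
  ∑ I ∈ (Finset.Icc 1 k).powersetCard p, ∏ i ∈ I, xv (QRing n) n i

/-- The polynomial
`F_p^k = ∑_{I ⊆ [k], |I| = p} ∏_{i ∈ I} (1 - x_i) ∏_{i ∈ I, i + 1 ∉ I} (1 - q_i)`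
(equal to `1` for `p = 0`). -/
def F (n k p : ℕ) : MvPolynomial (Fin n) (QRing n) :=
  ∑ I ∈ (Finset.Icc 1 k).powersetCard p,
    (∏ i ∈ I, (1 - xv (QRing n) n i)) * ∏ i ∈ I with i + 1 ∉ I, C (1 - qv n i)

/-- The polynomial `Ê_p^k = ∑_{i=0}^p (-1)^i binom(k-i, p-i) F_i^k` (for `p ≤ k`). -/
def Ehat (n k p : ℕ) : MvPolynomial (Fin n) (QRing n) :=
  ∑ i ∈ Finset.range (p + 1), (-1) ^ i * ((k - i).choose (p - i) : ℕ) * F n k i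

/-- The product `e_{p_1 … p_{n-1}} = e_{p_1}^1 ⋯ e_{p_{n-1}}^{n-1}`. -/
def eProd (n : ℕ) (p : Idx n) : MvPolynomial (Fin n) (QRing n) :=
  ∏ i : Fin (n - 1), e n ((i : ℕ) + 1) (p i)

/-- The product `F_{p_1 … p_{n-1}} = F_{p_1}^1 ⋯ F_{p_{n-1}}^{n-1}`. -/
def FProd (n : ℕ) (p : Idx n) : MvPolynomial (Fin n) (QRing n) :=
  ∏ i : Fin (n - 1), F n ((i : ℕ) + 1) (p i)

/-- The product `Ê_{p_1 … p_{n-1}} = Ê_{p_1}^1 ⋯ Ê_{p_{n-1}}^{n-1}`. -/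
def EhatProd (n : ℕ) (p : Idx n) : MvPolynomial (Fin n) (QRing n) :=
  ∏ i : Fin (n - 1), Ehat n ((i : ℕ) + 1) (p i)

/-! ### Grothendieck polynomials -/

theorem sub_swap_dvd {n : ℕ} (i j : Fin n) (f : MvPolynomial (Fin n) ℤ) :
    (X i - X j : MvPolynomial (Fin n) ℤ) ∣ f - rename (Equiv.swap i j) f := by
  rw [← Ideal.mem_span_singleton, ← Ideal.Quotient.mk_eq_mk_iff_sub_mem]
  set J : Ideal (MvPolynomial (Fin n) ℤ) := Ideal.span {X i - X j}
  have hij : Ideal.Quotient.mk J (X i) = Ideal.Quotient.mk J (X j) := by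
    rw [Ideal.Quotient.mk_eq_mk_iff_sub_mem]
    exact Ideal.mem_span_singleton_self _
  have h : Ideal.Quotient.mkₐ ℤ J =
      (Ideal.Quotient.mkₐ ℤ J).comp (rename (Equiv.swap i j)) := by
    apply MvPolynomial.algHom_ext
    intro k
    simp only [AlgHom.comp_apply, rename_X, Ideal.Quotient.mkₐ_eq_mk]
    rcases eq_or_ne k i with rfl | hi
    · rw [Equiv.swap_apply_left, hij]
    rcases eq_or_ne k j with rfl | hj
    · rw [Equiv.swap_apply_right, hij]
    · rw [Equiv.swap_apply_of_ne_of_ne hi hj]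
  exact DFunLike.congr_fun h f

/-- The divided difference `(f - s f) / (x_i - x_j)`, where `s` exchanges the variables `x_i` and
`x_j` (`i ≠ j`): the polynomial `g` with `f - s f = (x_i - x_j) g`. -/
def divDiff {n : ℕ} (i j : Fin n) (f : MvPolynomial (Fin n) ℤ) : MvPolynomial (Fin n) ℤ :=
  (sub_swap_dvd i j f).choose

theorem divDiff_spec {n : ℕ} (i j : Fin n) (f : MvPolynomial (Fin n) ℤ) :
    f - rename (Equiv.swap i j) f = (X i - X j) * divDiff i j f :=
  (sub_swap_dvd i j f).choose_spec

/-- The isobaric divided difference operator `π = 1 + (1 - x_i) ∂`, used with `j = i + 1`. -/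
def isobaric {n : ℕ} (i j : Fin n) (f : MvPolynomial (Fin n) ℤ) : MvPolynomial (Fin n) ℤ :=
  f + (1 - X i) * divDiff i j f

theorem swap_decreases {n : ℕ} (w : Equiv.Perm (Fin n)) (i j : Fin n) (hij : i < j)
    (hw : w i < w j) :
    ∑ a : Fin n, (a : ℕ) * ((w * Equiv.swap i j) a : ℕ) < ∑ a : Fin n, (a : ℕ) * (w a : ℕ) := by
  have hne : i ≠ j := hij.ne
  have hs : ∀ f : Fin n → ℕ, ∑ a, f a = f i + (f j + ∑ a ∈ (Finset.univ.erase i).erase j, f a) := by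
    intro f
    rw [Finset.add_sum_erase _ f (Finset.mem_erase.2 ⟨hne.symm, Finset.mem_univ j⟩),
      Finset.add_sum_erase _ f (Finset.mem_univ i)]
  rw [hs, hs (fun a => (a : ℕ) * (w a : ℕ))]
  have hrest : ∑ a ∈ (Finset.univ.erase i).erase j, (a : ℕ) * ((w * Equiv.swap i j) a : ℕ) =
      ∑ a ∈ (Finset.univ.erase i).erase j, (a : ℕ) * (w a : ℕ) := by
    refine Finset.sum_congr rfl fun a ha => ?_
    simp only [Finset.mem_erase, Finset.mem_univ, and_true] at ha
    rw [Equiv.Perm.mul_apply, Equiv.swap_apply_of_ne_of_ne ha.2 ha.1]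
  rw [hrest]
  simp only [Equiv.Perm.mul_apply, Equiv.swap_apply_left, Equiv.swap_apply_right]
  have h1 : (i : ℕ) < j := hij
  have h2 : (w i : ℕ) < w j := hw
  nlinarith

open Classical in
/-- The Grothendieck polynomial `𝔊_w` of `w ∈ S_n`, in one-line notation `w(1), …, w(n)` (zero-based
in Lean): `𝔊_{w_∘} = x_1^{n-1} x_2^{n-2} ⋯ x_{n-1}` for the longest element `w_∘ = n, n-1, …, 1`, the
only one without ascents, and `𝔊_w = π_i 𝔊_{w s_i}` if `w(i) < w(i+1)`. As the `π_i` satisfy the braid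
relations, every choice of the ascents gives the same polynomial; unwound, this is
`𝔊_w = π_{w⁻¹ w_∘} 𝔊_{w_∘}`. Below, `h.choose` is a pair `(i, i + 1)` with `w(i) < w(i+1)`. -/
def grothendieck (n : ℕ) (w : Equiv.Perm (Fin n)) : MvPolynomial (Fin n) ℤ :=
  if h : ∃ a : Fin n × Fin n, (a.1 : ℕ) + 1 = a.2 ∧ w a.1 < w a.2 then
    isobaric h.choose.1 h.choose.2
      (grothendieck n (w * Equiv.swap h.choose.1 h.choose.2))
  else ∏ j : Fin n, X j ^ (n - ((j : ℕ) + 1))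
termination_by ∑ a : Fin n, (a : ℕ) * (w a : ℕ)
decreasing_by
  exact swap_decreases w _ _ (Fin.lt_def.2 (by have := h.choose_spec.1; omega)) h.choose_spec.2

/-! ### The quantization map and quantum Grothendieck polynomials -/

open Classical in
/-- The `ℤ[q]`-linear quantization map `Q̂` on `L_n^q = ℤ[q] ⊗ L_n`, determined by
`Q̂(e_{p_1 … p_{n-1}}) = Ê_{p_1 … p_{n-1}}`: the products `e_{p_1 … p_{n-1}}` form a `ℤ[q]`-basis of
`L_n^q`, so that every `f` in `L_n^q` is `∑ c_p e_p` for exactly one family `c`, and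
`Q̂(f) = ∑ c_p Ê_p`. Outside `L_n^q` the value is `0`; it is never used. -/
def quantization (n : ℕ) (f : MvPolynomial (Fin n) (QRing n)) : MvPolynomial (Fin n) (QRing n) :=
  if h : ∃ c : Idx n → QRing n, f = ∑ p, c p • eProd n p then
    ∑ p, h.choose p • EhatProd n p
  else 0

/-- The quantum Grothendieck polynomial `𝔊_w^q = Q̂(𝔊_w)`. -/
def quantumGrothendieck (n : ℕ) (w : Equiv.Perm (Fin n)) : MvPolynomial (Fin n) (QRing n) :=
  quantization n (map (algebraMap ℤ (QRing n)) (grothendieck n w))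

/-- For `k < n`, the polynomial `G_p^k`: `G_0^k = 1` and, for `1 ≤ p ≤ k`, `G_p^k = 𝔊_{c[k,p]}^q` for
the cycle `c[k,p] = (k-p+1, k-p+2, …, k+1)`, which is `(k-p, …, k)` in the zero-based numbering. -/
def G (n k p : ℕ) (hk : k < n) : MvPolynomial (Fin n) (QRing n) :=
  if p = 0 then 1
  else quantumGrothendieck n (Fin.cycleIcc ⟨k - p, by omega⟩ ⟨k, hk⟩)

/-- The product `G_{p_1 … p_{n-1}} = G_{p_1}^1 ⋯ G_{p_{n-1}}^{n-1}`. -/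
def GProd (n : ℕ) (p : Idx n) : MvPolynomial (Fin n) (QRing n) :=
  ∏ i : Fin (n - 1), G n ((i : ℕ) + 1) (p i) (by omega)

/-- The image in `R[x]` of a polynomial in `ℤ[q][x]`. -/
def toR (n : ℕ) (f : MvPolynomial (Fin n) (QRing n)) : MvPolynomial (Fin n) (R n) :=
  map (algebraMap (QRing n) (R n)) f

/-- The family `v` of elements of `A[x]` is an `A`-linear basis of the submodule `M`. -/
def IsBasisOf {A ι : Type} [CommRing A] {n : ℕ} (v : ι → MvPolynomial (Fin n) A)
    (M : Submodule A (MvPolynomial (Fin n) A)) : Prop :=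
  LinearIndependent A v ∧ Submodule.span A (Set.range v) = M

end

end QGroth

/-! Each family has n! members and the staircase module `L` is free of rank n!. A surjective
endomorphism of a finitely generated module over a commutative ring is injective, so it is enough
that each family spans (`isBasisOf_of_span`).

The F-products. The substitution y_i = 1 - x_i preserves the staircase module and turns F_p^k into ∑
c(I) ∏_{i ∈ I} y_i over the p-subsets I of [k], where each weight c(I) is a unit of R. For arbitrary
unit weights, the straightening lemma `box_le_mul_span_wesymm` writes a polynomial in the staircase
of [k+1] as a combination of these weighted elementary polynomials of level k with coefficients in
the staircase of [k]. Iterating, `L` is the product over k of the spans of F_0^k, …, F_k^k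
(`span_toR_F`). With all weights 1 the same argument gives the basis of products of e_p^k.

The products of Ê and G. In a product of spans, every level may be replaced by generators related to
it by an invertible triangular matrix. Ê_p^k is triangular in the F_i^k with diagonal entries
(-1)^p. For G, the classical polynomial of c[k,p] is ∑ a_j e_j^k with a_j = 0 for j < p and a_p = 1
(`exists_grothendieck_cyc`, `esymComb_cyc_coeff`); quantization replaces e_j^k by Ê_j^k, so G is
unitriangular in Ê.

The quantum Grothendieck polynomials. Quantization is linear and carries the e-products to the
Ê-products, which span, so it suffices that the classical 𝔊_w span L_n over ℤ (`span_grothendieck`).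
Composites of isobaric operators followed by the constant term give functionals that are
unitriangular on the 𝔊_w with respect to length. This rests on three facts: the recursion holds at
every ascent, 𝔊_1 = 1, and 𝔊_w vanishes at the origin for w ≠ 1. -/

namespace QGroth

noncomputable section

open MvPolynomial

/-! ### Polynomials with bounded exponents -/

section Box

variable {σ : Type*} {A : Type*} [CommRing A]

/-- The polynomials all of whose monomials have exponent vectors bounded by `β`. -/
def box (A : Type*) [CommRing A] (β : σ → ℕ) : Submodule A (MvPolynomial σ A) :=
  restrictSupport A {a | ∀ i, a i ≤ β i}

theorem monomial_mem_box {β : σ → ℕ} {a : σ →₀ ℕ} (h : ∀ i, a i ≤ β i) (r : A) :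
    monomial a r ∈ box A β :=
  (monomial_mem_restrictSupport A).2 (Or.inl h)

theorem mem_box_iff {β : σ → ℕ} {f : MvPolynomial σ A} :
    f ∈ box A β ↔ ∀ a, coeff a f ≠ 0 → ∀ i, a i ≤ β i := by
  rw [box, mem_restrictSupport_iff]
  simp only [Set.subset_def, Finset.mem_coe, mem_support_iff, Set.mem_ofPred_eq]

theorem box_eq_span (β : σ → ℕ) :
    box A β = Submodule.span A ((monomial · 1) '' {a : σ →₀ ℕ | ∀ i, a i ≤ β i}) :=
  restrictSupport_eq_span A _

theorem box_le_iff {β : σ → ℕ} {N : Submodule A (MvPolynomial σ A)} :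
    box A β ≤ N ↔ ∀ a : σ →₀ ℕ, (∀ i, a i ≤ β i) → monomial a 1 ∈ N := by
  rw [box_eq_span, Submodule.span_le, Set.image_subset_iff]
  rfl

theorem box_mono {β γ : σ → ℕ} (h : ∀ i, β i ≤ γ i) : box A β ≤ box A γ :=
  restrictSupport_mono A fun _ ha i => (ha i).trans (h i)

open scoped Pointwise in
theorem mul_mem_box {β γ δ : σ → ℕ} (h : ∀ i, β i + γ i ≤ δ i) {f g : MvPolynomial σ A}
    (hf : f ∈ box A β) (hg : g ∈ box A γ) : f * g ∈ box A δ := by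
  have h1 : f * g ∈ restrictSupport A
      ({a : σ →₀ ℕ | ∀ i, a i ≤ β i} + {a : σ →₀ ℕ | ∀ i, a i ≤ γ i}) := by
    rw [restrictSupport_add]
    exact Submodule.mul_mem_mul hf hg
  refine restrictSupport_mono A ?_ h1
  rintro _ ⟨a, ha, b, hb, rfl⟩ i
  exact (add_le_add (ha i) (hb i)).trans (h i)

theorem one_mem_box (β : σ → ℕ) : (1 : MvPolynomial σ A) ∈ box A β :=
  monomial_mem_box (a := 0) (fun _ => Nat.zero_le _) 1

theorem C_mem_box (β : σ → ℕ) (r : A) : (C r : MvPolynomial σ A) ∈ box A β :=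
  monomial_mem_box (a := 0) (fun _ => Nat.zero_le _) r

variable [DecidableEq σ]

/-- The indicator function of `s`. -/
def ind (s : Finset σ) (i : σ) : ℕ := if i ∈ s then 1 else 0

theorem prod_X_mem_box (s : Finset σ) : (∏ i ∈ s, X i : MvPolynomial σ A) ∈ box A (ind s) := by
  induction s using Finset.induction_on with
  | empty => simpa using one_mem_box _
  | insert j s hj ih =>
    rw [Finset.prod_insert hj]
    refine mul_mem_box (β := ind {j}) (γ := ind s) ?_ ?_ ih
    · intro i
      by_cases h1 : i = j
      · subst h1; simp [ind, hj]
      · simp [ind, h1]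
    · refine monomial_mem_box (fun i => ?_) 1
      by_cases h1 : i = j
      · subst h1; simp [ind]
      · simp [ind, h1]

end Box

/-! ### Straightening with weighted elementary symmetric polynomials -/

section Straightening

variable {A : Type*} [CommRing A]

/-- The weighted elementary symmetric polynomial `∑_{I ⊆ s, |I| = p} c(I) ∏_{i ∈ I} X_i`. -/
def wesymm (c : Finset ℕ → A) (s : Finset ℕ) (p : ℕ) : MvPolynomial ℕ A :=
  ∑ I ∈ s.powersetCard p, C (c I) * ∏ i ∈ I, X i

/-- The staircase of exponents on `s`: the value at `i ∈ s` is the number of larger elements. -/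
def stair (s : Finset ℕ) (i : ℕ) : ℕ := if i ∈ s then (s.filter (i < ·)).card else 0

theorem wesymm_mem_box (c : Finset ℕ → A) (s : Finset ℕ) (p : ℕ) :
    wesymm c s p ∈ box A (ind s) := by
  refine Submodule.sum_mem _ fun I hI => ?_
  refine mul_mem_box (β := 0) (γ := ind I) ?_ (C_mem_box _ _) (prod_X_mem_box I)
  intro i
  have := (Finset.mem_powersetCard.1 hI).1
  by_cases h : i ∈ I
  · simp [ind, h, this h]
  · simp [ind, h]

/-- Split the sets I according to whether m ∈ I. The weights need not factor, so the cofactor K of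
X_m carries the shifted weights c(I ∪ {m}) and is not in the original family; only its exponent
bound matters later. -/
theorem wesymm_eq_erase_add (c : Finset ℕ → A) (s : Finset ℕ) {m : ℕ} (hm : m ∈ s) (p : ℕ) :
    ∃ K ∈ box A (ind (s.erase m)), wesymm c s p = wesymm c (s.erase m) p + X m * K := by
  rcases p with _ | p
  · exact ⟨0, Submodule.zero_mem _, by simp [wesymm]⟩
  · refine ⟨wesymm (fun I => c (insert m I)) (s.erase m) p, wesymm_mem_box _ _ _, ?_⟩
    have hn : m ∉ s.erase m := Finset.notMem_erase m s
    conv_lhs => rw [← Finset.insert_erase hm]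
    rw [wesymm, Finset.powersetCard_succ_insert hn, Finset.sum_union, Finset.sum_image]
    · congr 1
      rw [wesymm, Finset.mul_sum]
      refine Finset.sum_congr rfl fun I hI => ?_
      have hI' : m ∉ I := fun h => hn ((Finset.mem_powersetCard.1 hI).1 h)
      rw [Finset.prod_insert hI']
      ring
    · intro I hI J hJ h
      have hI' : m ∉ I := fun h => hn ((Finset.mem_powersetCard.1 hI).1 h)
      have hJ' : m ∉ J := fun h => hn ((Finset.mem_powersetCard.1 hJ).1 h)
      rw [← Finset.erase_insert hI', h, Finset.erase_insert hJ']
    · rw [Finset.disjoint_left]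
      intro I hI hJ
      obtain ⟨J, -, rfl⟩ := Finset.mem_image.1 hJ
      exact hn ((Finset.mem_powersetCard.1 hI).1 (Finset.mem_insert_self _ _))

theorem stair_erase_of_lt {s : Finset ℕ} {m i : ℕ} (hm : m ∈ s) (hi : i ∈ s) (h : i < m) :
    stair (s.erase m) i + 1 = stair s i := by
  have h1 : (s.erase m).filter (i < ·) = (s.filter (i < ·)).erase m := by
    ext j; simp only [Finset.mem_filter, Finset.mem_erase]; tauto
  rw [stair, stair, if_pos (Finset.mem_erase.2 ⟨h.ne, hi⟩), if_pos hi, h1,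
    Finset.card_erase_add_one (Finset.mem_filter.2 ⟨hm, h⟩)]

theorem stair_erase_of_gt {s : Finset ℕ} {m i : ℕ} (h : m < i) :
    stair (s.erase m) i = stair s i := by
  have h1 : (s.erase m).filter (i < ·) = s.filter (i < ·) := by
    ext j; simp only [Finset.mem_filter, Finset.mem_erase]
    exact ⟨fun h => ⟨h.1.2, h.2⟩, fun h' => ⟨⟨(h.trans h'.2).ne', h'.1⟩, h'.2⟩⟩
  simp only [stair, h1, Finset.mem_erase, h.ne', ne_eq, not_false_eq_true, true_and]

theorem stair_erase_self (s : Finset ℕ) (m : ℕ) : stair (s.erase m) m = 0 := by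
  simp [stair]

theorem stair_of_notMem {s : Finset ℕ} {i : ℕ} (h : i ∉ s) : stair s i = 0 := by
  simp [stair, h]

/-- If all the weights are units, every polynomial with exponents at most one above the staircase
is a combination of weighted elementary symmetric polynomials with coefficients in the
staircase. -/
theorem box_le_mul_span_wesymm (c : Finset ℕ → A) (hc : ∀ I, IsUnit (c I)) (s : Finset ℕ) :
    box A (fun i => ind s i + stair s i) ≤
      box A (stair s) * Submodule.span A (Set.range (wesymm c s)) := by
  induction s using Finset.strongInduction with
  | H s IH =>
  set S := box A (stair s) * Submodule.span A (Set.range (wesymm c s)) with hS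
  have hmem : ∀ g ∈ box A (stair s), ∀ p, g * wesymm c s p ∈ S := fun g hg p =>
    Submodule.mul_mem_mul hg (Submodule.subset_span ⟨p, rfl⟩)
  set T : ℕ → Finset ℕ := fun m => s.filter (· < m) with hT
  have hTm : ∀ m i, i ∈ T m ↔ i ∈ s ∧ i < m := fun m i => by simp [hT]
  -- Descending induction on m, with d as fuel: the factor ∏_{i ∈ T m} X_i collects the variables of
  -- s below m. At m = 0 it is empty, and once m exceeds every element of s it is the full product
  -- over s.
  have key : ∀ d m : ℕ, s.sup id + 1 ≤ m + d →
      ∀ a : ℕ →₀ ℕ, (∀ i, a i + ind (T m) i ≤ ind s i + stair s i) →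
        (∏ i ∈ T m, X i) * monomial a 1 ∈ S := by
    intro d
    induction d with
    | zero =>
      intro m hm a ha
      have hTs : T m = s := by
        ext i
        rw [hTm]
        refine ⟨fun h => h.1, fun h => ⟨h, ?_⟩⟩
        have : i ≤ s.sup id := Finset.le_sup (f := id) h
        omega
      rw [hTs] at ha ⊢
      -- The weighted polynomial of top degree is the single term c(s) ∏_{i ∈ s} X_i, so inverting
      -- c(s) exhibits the full product as a member of the span.
      obtain ⟨v, hv⟩ := (hc s).exists_left_inv
      have h1 : (∏ i ∈ s, X i) * monomial a (1 : A) =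
          (C v * monomial a 1) * wesymm c s s.card := by
        rw [wesymm, Finset.powersetCard_self, Finset.sum_singleton]
        have : (C v * C (c s) : MvPolynomial ℕ A) = 1 := by rw [← C_mul, hv, C_1]
        linear_combination (-(∏ i ∈ s, X i) * monomial a (1 : A)) * this
      rw [h1]
      refine hmem _ ?_ _
      rw [← smul_eq_C_mul]
      refine Submodule.smul_mem _ _ (monomial_mem_box (fun i => ?_) 1)
      have := ha i
      omega
    | succ d ih =>
      intro m hm a ha
      have ih' := ih (m + 1) (by omega)
      by_cases hms : m ∈ s
      swap
      · have : T (m + 1) = T m := by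
          ext i
          rw [hTm, hTm]
          refine ⟨fun h => ⟨h.1, ?_⟩, fun h => ⟨h.1, by omega⟩⟩
          have : i ≠ m := fun h' => hms (h' ▸ h.1)
          omega
        rw [this] at ih'
        exact ih' a ha
      have hmT : m ∉ T m := by simp [hTm]
      have hT1 : T (m + 1) = insert m (T m) := by
        ext i
        rw [Finset.mem_insert, hTm, hTm]
        constructor
        · rintro ⟨h1, h2⟩
          by_cases h : i = m
          · exact Or.inl h
          · exact Or.inr ⟨h1, by omega⟩
        · rintro (rfl | ⟨h1, h2⟩)
          · exact ⟨hms, by omega⟩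
          · exact ⟨h1, by omega⟩
      have hXbox : ∀ f ∈ box A (fun i => ind s i + stair s i - ind (T (m + 1)) i),
          (∏ i ∈ T (m + 1), X i) * f ∈ S := by
        intro f hf
        have : box A (fun i => ind s i + stair s i - ind (T (m + 1)) i) ≤
            S.comap (LinearMap.mulLeft A (∏ i ∈ T (m + 1), X i)) := by
          rw [box_le_iff]
          intro b hb
          refine ih' b fun i => ?_
          have h1 := hb i
          have h2 : ind (T (m + 1)) i ≤ ind s i := by
            by_cases h : i ∈ T (m + 1)
            · simp [ind, h, ((hTm _ _).1 h).1]
            · simp [ind, h]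
          omega
        exact this hf
      rw [hT1, Finset.prod_insert hmT] at hXbox
      have hindT : ∀ i, ind (insert m (T m)) i = ind (T m) i + if i = m then 1 else 0 := by
        intro i
        by_cases h : i = m
        · subst h; simp [ind, hmT]
        · simp [ind, h]
      have hTi : ∀ i, ind (T m) i = if i ∈ s ∧ i < m then 1 else 0 := by
        intro i; simp only [ind, hTm]
      by_cases ham : a m = 0
      · -- the exponent of `X m` vanishes: use the statement for `s.erase m`
        have h1 : monomial a (1 : A) ∈ box A (stair (s.erase m)) *
            Submodule.span A (Set.range (wesymm c (s.erase m))) := by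
          refine IH _ (Finset.erase_ssubset hms) (monomial_mem_box (fun i => ?_) 1)
          have h1 := ha i
          rw [hTi] at h1
          rcases lt_trichotomy i m with h | h | h
          · by_cases his : i ∈ s
            · have := stair_erase_of_lt hms his h
              simp [ind, his, h, h.ne] at h1 ⊢
              omega
            · simp [ind, his, stair_of_notMem his] at h1 ⊢
              omega
          · subst h; omega
          · rw [stair_erase_of_gt h]
            simp [ind, h.ne', not_lt.2 h.le] at h1 ⊢
            exact h1
        have h2 : box A (stair (s.erase m)) *
            Submodule.span A (Set.range (wesymm c (s.erase m))) ≤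
              S.comap (LinearMap.mulLeft A (∏ i ∈ T m, X i)) := by
          rw [Submodule.mul_le]
          intro g hg f hf
          have h3 : Submodule.span A (Set.range (wesymm c (s.erase m))) ≤
              S.comap (LinearMap.mulLeft A ((∏ i ∈ T m, X i) * g)) := by
            rw [Submodule.span_le]
            rintro _ ⟨p, rfl⟩
            obtain ⟨K, hK, hKe⟩ := wesymm_eq_erase_add c s hms p
            -- The first term has coefficient in the staircase of s, because erasing m lowered the
            -- staircase by one exactly at the elements of s below m, which makes room for ∏_{T m}
            -- X_i. The second contains X_m, so it falls under m + 1.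
            have h4 : (∏ i ∈ T m, X i) * g * wesymm c (s.erase m) p =
                ((∏ i ∈ T m, X i) * g) * wesymm c s p -
                  (X m * ∏ i ∈ T m, X i) * (g * K) := by
              rw [hKe]; ring
            change (∏ i ∈ T m, X i) * g * wesymm c (s.erase m) p ∈ S
            rw [h4]
            refine Submodule.sub_mem _ (hmem _ ?_ _) (hXbox _ ?_)
            · refine mul_mem_box (fun i => ?_) (prod_X_mem_box (T m)) hg
              rw [hTi]
              rcases lt_trichotomy i m with h | h | h
              · by_cases his : i ∈ s
                · have := stair_erase_of_lt hms his h
                  simp [his, h]; omega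
                · simp [his, stair_of_notMem]
              · subst h; simp [stair_erase_self]
              · rw [stair_erase_of_gt h]; simp [not_lt.2 h.le]
            · refine mul_mem_box (fun i => ?_) hg hK
              rw [hindT, hTi]
              rcases lt_trichotomy i m with h | h | h
              · by_cases his : i ∈ s
                · have := stair_erase_of_lt hms his h
                  simp [his, h, h.ne, ind]; omega
                · simp [his, stair_of_notMem, ind]
              · subst h; simp [stair_erase_self, ind]
              · rw [stair_erase_of_gt h]
                simp [not_lt.2 h.le, h.ne', ind]; omega
          have := h3 hf
          rw [Submodule.mem_comap, LinearMap.mulLeft_apply, mul_assoc] at this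
          exact this
        exact h2 h1
      -- If X_m divides the monomial, move it into the collected product and pass to m + 1.
      · have h1 : monomial a (1 : A) = X m * monomial (a - Finsupp.single m 1) 1 := by
          rw [X, monomial_mul, one_mul]
          have h2 : a = Finsupp.single m 1 + (a - Finsupp.single m 1) := by
            ext i
            by_cases h : i = m
            · subst h; simp; omega
            · simp [Ne.symm h]
          rw [← h2]
        have h2 := hXbox (monomial (a - Finsupp.single m 1) 1) (monomial_mem_box (fun i => ?_) 1)
        · rw [h1]
          convert h2 using 1
          ring
        · have h1 := ha i
          rw [hindT]
          by_cases h : i = m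
          · subst h; simp; omega
          · simp [h]; omega
  rw [box_le_iff]
  intro a ha
  have hT0 : T 0 = ∅ := by ext i; simp [hTm]
  have := key (s.sup id + 1) 0 (by omega) a (fun i => by simpa [hT0, ind] using ha i)
  simpa [hT0] using this

end Straightening

/-- This identity is what allows the straightening lemma to be iterated along the intervals [1, k].
-/
theorem ind_add_stair_Icc (k i : ℕ) :
    ind (Finset.Icc 1 k) i + stair (Finset.Icc 1 k) i = stair (Finset.Icc 1 (k + 1)) i := by
  have h : ∀ k : ℕ, 1 ≤ i → (Finset.Icc 1 k).filter (i < ·) = Finset.Ioc i k := by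
    intro k hi; ext j; simp only [Finset.mem_filter, Finset.mem_Icc, Finset.mem_Ioc]; omega
  simp only [ind, stair, Finset.mem_Icc]
  by_cases h1 : 1 ≤ i
  · simp only [h _ h1, Nat.card_Ioc]
    split_ifs <;> omega
  · simp [h1]

theorem stair_Icc (k i : ℕ) : stair (Finset.Icc 1 k) i = if 1 ≤ i then k - i else 0 := by
  have h : 1 ≤ i → (Finset.Icc 1 k).filter (i < ·) = Finset.Ioc i k := by
    intro hi; ext j; simp only [Finset.mem_filter, Finset.mem_Icc, Finset.mem_Ioc]; omega
  simp only [stair, Finset.mem_Icc]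
  by_cases h1 : 1 ≤ i
  · simp only [h h1, Nat.card_Ioc]
    split_ifs <;> omega
  · simp [h1]

/-! ### The staircase module as a product of spans -/

section Products

variable {A : Type*} [CommRing A]

theorem box_stair_succ (c : Finset ℕ → A) (hc : ∀ I, IsUnit (c I)) (k : ℕ) :
    box A (stair (Finset.Icc 1 (k + 1))) =
      box A (stair (Finset.Icc 1 k)) *
        Submodule.span A (Set.range (wesymm c (Finset.Icc 1 k))) := by
  have h : (fun i => ind (Finset.Icc 1 k) i + stair (Finset.Icc 1 k) i) =
      stair (Finset.Icc 1 (k + 1)) := funext (ind_add_stair_Icc k)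
  refine le_antisymm ?_ ?_
  · rw [← h]; exact box_le_mul_span_wesymm c hc _
  · rw [Submodule.mul_le]
    intro f hf g hg
    have hle : Submodule.span A (Set.range (wesymm c (Finset.Icc 1 k))) ≤
        box A (ind (Finset.Icc 1 k)) := by
      rw [Submodule.span_le]
      rintro _ ⟨p, rfl⟩
      exact wesymm_mem_box _ _ _
    exact mul_mem_box (fun i => by rw [← ind_add_stair_Icc, add_comm]) hf (hle hg)

theorem box_stair_eq_prod (c : Finset ℕ → A) (hc : ∀ I, IsUnit (c I)) (m : ℕ) :
    box A (stair (Finset.Icc 1 (m + 1))) =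
      ∏ i ∈ Finset.range m, Submodule.span A (Set.range (wesymm c (Finset.Icc 1 (i + 1)))) := by
  induction m with
  | zero =>
    rw [Finset.range_zero, Finset.prod_empty, Submodule.one_eq_span, box_eq_span]
    congr 1
    ext f
    constructor
    · rintro ⟨a, ha, rfl⟩
      have : a = 0 := by
        ext i
        have := ha i
        rw [stair_Icc] at this
        simp only [Finsupp.coe_zero, Pi.zero_apply]
        split_ifs at this <;> omega
      subst this
      rfl
    · rintro rfl
      exact ⟨0, fun _ => Nat.zero_le _, rfl⟩
  | succ m ih => rw [box_stair_succ c hc, ih, Finset.prod_range_succ]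

theorem span_range_wesymm (c : Finset ℕ → A) (k : ℕ) :
    Submodule.span A (Set.range (wesymm c (Finset.Icc 1 k))) =
      Submodule.span A (Set.range fun p : Fin (k + 1) => wesymm c (Finset.Icc 1 k) p) := by
  refine le_antisymm ?_ (Submodule.span_mono ?_)
  · rw [Submodule.span_le]
    rintro _ ⟨p, rfl⟩
    by_cases hp : p < k + 1
    · exact Submodule.subset_span ⟨⟨p, hp⟩, rfl⟩
    · have : wesymm c (Finset.Icc 1 k) p = 0 := by
        rw [wesymm, Finset.powersetCard_eq_empty.2 (by simp; omega), Finset.sum_empty]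
      rw [this]
      exact Submodule.zero_mem _
  · rintro _ ⟨p, rfl⟩
    exact ⟨p, rfl⟩

theorem prod_span_range {P ι : Type*} [CommRing P] [Algebra A P] [Fintype ι] [DecidableEq ι]
    {κ : ι → Type*} (v : (i : ι) → κ i → P) :
    ∏ i, Submodule.span A (Set.range (v i)) =
      Submodule.span A (Set.range fun p : (i : ι) → κ i => ∏ i, v i (p i)) := by
  rw [Submodule.prod_span]
  congr 1
  ext f
  rw [Set.mem_fintype_prod]
  constructor
  · rintro ⟨g, hg, rfl⟩
    choose p hp using hg
    exact ⟨p, by simp [hp]⟩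
  · rintro ⟨p, rfl⟩
    exact ⟨fun i => v i (p i), fun i => ⟨p i, rfl⟩, rfl⟩

/-- The substitution `X_i ↦ 1 - X_i`. -/
def reflect (A : Type*) [CommRing A] : MvPolynomial ℕ A →ₐ[A] MvPolynomial ℕ A :=
  aeval fun i => 1 - X i

theorem reflect_reflect (f : MvPolynomial ℕ A) : reflect A (reflect A f) = f := by
  have : (reflect A).comp (reflect A) = AlgHom.id A _ := by
    ext i
    simp [reflect]
  exact DFunLike.congr_fun this f

theorem reflect_monomial_mem_box (a : ℕ →₀ ℕ) : reflect A (monomial a 1) ∈ box A a := by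
  induction a using Finsupp.induction_linear with
  | zero =>
    have : reflect A (monomial 0 1) = 1 := by
      rw [show (monomial (0 : ℕ →₀ ℕ) (1 : A)) = 1 from rfl, map_one]
    rw [this]
    exact one_mem_box _
  | add f g hf hg =>
    have : (monomial (f + g) (1 : A)) = monomial f 1 * monomial g 1 := by
      rw [monomial_mul, one_mul]
    rw [this, map_mul]
    exact mul_mem_box (fun i => le_rfl) hf hg
  | single i e =>
    induction e with
    | zero => simpa using one_mem_box _
    | succ e ih =>
      have : (monomial (Finsupp.single i (e + 1)) (1 : A)) =
          monomial (Finsupp.single i e) 1 * X i := by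
        rw [X, monomial_mul, one_mul, Finsupp.single_add]
      rw [this, map_mul]
      refine mul_mem_box (β := (Finsupp.single i e : ℕ →₀ ℕ))
        (γ := (Finsupp.single i 1 : ℕ →₀ ℕ)) (fun j => ?_) ih ?_
      · rw [Finsupp.single_add]; rfl
      · rw [reflect, aeval_X]
        exact Submodule.sub_mem _ (one_mem_box _) (monomial_mem_box (fun _ => le_rfl) 1)

/-- The substitution does not raise the degree in any variable, and it is an involution, so
inclusion gives equality. -/
theorem map_reflect_box (β : ℕ → ℕ) :
    Submodule.map (reflect A).toLinearMap (box A β) = box A β := by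
  have h : box A β ≤ Submodule.comap (reflect A).toLinearMap (box A β) := by
    rw [box_le_iff]
    exact fun a ha => box_mono ha (reflect_monomial_mem_box a)
  refine le_antisymm (Submodule.map_le_iff_le_comap.2 h) fun f hf => ?_
  exact ⟨reflect A f, h hf, reflect_reflect f⟩

end Products

/-! ### Transfer to n variables, and counting ranks -/

section Staircase

variable {A : Type} [CommRing A] {n : ℕ}

theorem L_eq_box : L A n = box A fun j : Fin n => n - ((j : ℕ) + 1) := by
  rw [L, box_eq_span]
  congr 1
  ext f
  constructor
  · rintro ⟨a, ha, rfl⟩; exact ⟨a, ha, rfl⟩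
  · rintro ⟨a, ha, rfl⟩; exact ⟨a, ha, rfl⟩

theorem aeval_xv_monomial (a : Fin n →₀ ℕ) :
    aeval (xv A n) (monomial (a.mapDomain fun j : Fin n => (j : ℕ) + 1) (1 : A)) =
      monomial a 1 := by
  have hinj : Function.Injective fun j : Fin n => (j : ℕ) + 1 := fun i j h => by
    have : (i : ℕ) + 1 = j + 1 := h
    exact Fin.ext (by omega)
  rw [aeval_monomial, map_one, one_mul, Finsupp.prod_mapDomain_index_inj hinj,
    monomial_eq, C_1, one_mul]
  refine Finsupp.prod_congr fun j _ => ?_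
  have : 1 ≤ (j : ℕ) + 1 ∧ (j : ℕ) + 1 ≤ n := ⟨by omega, j.2⟩
  rw [xv, dif_pos this]
  rfl

theorem map_aeval_xv_box :
    Submodule.map (aeval (xv A n)).toLinearMap (box A (stair (Finset.Icc 1 n))) = L A n := by
  have hinj : Function.Injective fun j : Fin n => (j : ℕ) + 1 := fun i j h => by
    have : (i : ℕ) + 1 = j + 1 := h
    exact Fin.ext (by omega)
  refine le_antisymm ?_ ?_
  · rw [Submodule.map_le_iff_le_comap, box_le_iff]
    intro a ha
    have hsupp : (a.support : Set ℕ) ⊆ Set.range fun j : Fin n => (j : ℕ) + 1 := by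
      intro i hi
      have h1 := ha i
      have h2 : a i ≠ 0 := Finsupp.mem_support_iff.1 hi
      rw [stair_Icc] at h1
      split_ifs at h1 with h
      · exact ⟨⟨i - 1, by omega⟩, by simp; omega⟩
      · omega
    have h1 : (a.comapDomain _ hinj.injOn).mapDomain (fun j : Fin n => (j : ℕ) + 1) = a :=
      Finsupp.mapDomain_comapDomain _ hinj a hsupp
    rw [Submodule.mem_comap, ← h1, AlgHom.toLinearMap_apply, aeval_xv_monomial, L_eq_box]
    refine monomial_mem_box (fun j => ?_) 1
    have := ha (j + 1)
    rw [stair_Icc] at this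
    simpa using this
  · rw [L_eq_box, box_le_iff]
    intro a ha
    refine ⟨monomial (a.mapDomain fun j : Fin n => (j : ℕ) + 1) 1, monomial_mem_box (fun i => ?_) 1,
      aeval_xv_monomial a⟩
    rw [stair_Icc]
    by_cases hi : i ∈ Set.range fun j : Fin n => (j : ℕ) + 1
    · obtain ⟨j, rfl⟩ := hi
      have h1 := Finsupp.mapDomain_apply hinj a j
      rw [h1]
      simpa using ha j
    · rw [Finsupp.mapDomain_of_notMem_range a i hi]
      exact Nat.zero_le _

theorem map_aeval_one_sub_xv_box :
    Submodule.map (aeval fun i => 1 - xv A n i).toLinearMap (box A (stair (Finset.Icc 1 n))) =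
      L A n := by
  have h : (aeval fun i => 1 - xv A n i) = (aeval (xv A n)).comp (reflect A) := by
    ext i
    simp [reflect]
  rw [h, AlgHom.comp_toLinearMap, Submodule.map_comp, map_reflect_box, map_aeval_xv_box]

/-- The substitution y is left open so as to serve both y_i = x_i (the e-products) and y_i = 1 - x_i
(the F-products). -/
theorem span_prod_aeval_wesymm (y : ℕ → MvPolynomial (Fin n) A)
    (hy : Submodule.map (aeval y).toLinearMap (box A (stair (Finset.Icc 1 n))) = L A n)
    (c : Finset ℕ → A) (hc : ∀ I, IsUnit (c I)) :
    ∏ i : Fin (n - 1), Submodule.span A (Set.range fun p : Fin ((i : ℕ) + 2) =>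
      aeval y (wesymm c (Finset.Icc 1 ((i : ℕ) + 1)) p)) = L A n := by
  have hbox : box A (stair (Finset.Icc 1 n)) = box A (stair (Finset.Icc 1 (n - 1 + 1))) := by
    congr 1
    ext i
    rw [stair_Icc, stair_Icc]
    split_ifs <;> omega
  rw [← hy, hbox, box_stair_eq_prod c hc, Finset.prod_range]
  have h := map_prod (Submodule.mapHom (aeval y)) (fun i : Fin (n - 1) =>
    Submodule.span A (Set.range (wesymm c (Finset.Icc 1 ((i : ℕ) + 1))))) Finset.univ
  change Submodule.map (aeval y).toLinearMap _ = _ at h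
  rw [h]
  refine Finset.prod_congr rfl fun i _ => ?_
  change _ = Submodule.map (aeval y).toLinearMap _
  rw [span_range_wesymm, Submodule.map_span, ← Set.range_comp]
  rfl

theorem card_staircase (n : ℕ) :
    Nat.card {a : Fin n →₀ ℕ | ∀ j, a j ≤ n - ((j : ℕ) + 1)} = n.factorial := by
  have e : {a : Fin n →₀ ℕ | ∀ j, a j ≤ n - ((j : ℕ) + 1)} ≃
      ((j : Fin n) → Fin (n - ((j : ℕ) + 1) + 1)) :=
    { toFun := fun a j => ⟨a.1 j, Nat.lt_succ_of_le (a.2 j)⟩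
      invFun := fun f => ⟨Finsupp.equivFunOnFinite.symm fun j => (f j : ℕ),
        fun j => Nat.le_of_lt_succ (f j).2⟩
      left_inv := fun a => by ext; simp
      right_inv := fun f => by ext; simp }
  rw [Nat.card_congr e, Nat.card_eq_fintype_card, Fintype.card_pi]
  simp only [Fintype.card_fin]
  rw [Fin.prod_univ_eq_prod_range (fun j => n - (j + 1) + 1) n,
    ← Finset.prod_range_add_one_eq_factorial, ← Finset.prod_range_reflect]
  refine Finset.prod_congr rfl fun j hj => ?_
  have := Finset.mem_range.1 hj
  omega

/-- The monomial basis of `L A n`, indexed by any type with `n!` elements. -/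
def basisL {ι : Type} [Fintype ι] (hι : Fintype.card ι = n.factorial) :
    Module.Basis ι A (L A n) :=
  haveI : Finite {a : Fin n →₀ ℕ | ∀ j, a j ≤ n - ((j : ℕ) + 1)} :=
    Nat.finite_of_card_ne_zero (by rw [card_staircase]; exact n.factorial_ne_zero)
  ((basisRestrictSupport A {a : Fin n →₀ ℕ | ∀ j, a j ≤ n - ((j : ℕ) + 1)}).reindex
    (Finite.card_eq.1 (by rw [card_staircase, Nat.card_eq_fintype_card, hι])).some).map
      (LinearEquiv.ofEq _ _ L_eq_box.symm)

theorem isBasisOf_of_span {ι : Type} [Fintype ι] (hι : Fintype.card ι = n.factorial)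
    (v : ι → MvPolynomial (Fin n) A) (hv : Submodule.span A (Set.range v) = L A n) :
    IsBasisOf v (L A n) := by
  refine ⟨?_, hv⟩
  have hmem : ∀ i, v i ∈ L A n := fun i => hv ▸ Submodule.subset_span ⟨i, rfl⟩
  set g : (ι → A) →ₗ[A] L A n := Fintype.linearCombination A fun i => (⟨v i, hmem i⟩ : L A n)
  have hg : Function.Surjective g := by
    rintro ⟨f, hf⟩
    rw [← hv, Submodule.mem_span_range_iff_exists_fun] at hf
    obtain ⟨c, rfl⟩ := hf
    refine ⟨c, Subtype.ext ?_⟩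
    simp [g, Fintype.linearCombination_apply]
  set b : Module.Basis ι A (L A n) := basisL hι
  -- Source and target are both A^ι, so surjectivity forces injectivity.
  have hinj : Function.Injective (b.equivFun.toLinearMap ∘ₗ g) :=
    OrzechProperty.injective_of_surjective_endomorphism _
      (by rw [LinearMap.coe_comp]; exact b.equivFun.surjective.comp hg)
  have hginj : Function.Injective g := by
    rw [LinearMap.coe_comp] at hinj
    exact hinj.of_comp
  have hli : LinearIndependent A fun i => (⟨v i, hmem i⟩ : L A n) :=
    linearIndependent_iff_injective_fintypeLinearCombination.2 hginj
  exact hli.map' (L A n).subtype (Submodule.ker_subtype _)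

theorem card_idx (n : ℕ) : Fintype.card (Idx n) = n.factorial := by
  rw [Fintype.card_pi]
  simp only [Fintype.card_fin]
  rw [Fin.prod_univ_eq_prod_range (fun i => i + 2) (n - 1)]
  rcases n with _ | n
  · rfl
  · rw [← Finset.prod_range_add_one_eq_factorial, Finset.prod_range_succ', Nat.add_sub_cancel]
    simp

end Staircase

/-! ### The families of `F` and `Ê` -/

theorem map_xv {A B : Type} [CommRing A] [CommRing B] (f : A →+* B) (n i : ℕ) :
    map f (xv A n i) = xv B n i := by
  simp only [xv]
  split_ifs
  · exact map_X f _
  · exact map_zero _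

theorem isUnit_one_sub_qv (n i : ℕ) : IsUnit (algebraMap (QRing n) (R n) (1 - qv n i)) := by
  simp only [qv]
  split_ifs with h
  · exact IsLocalization.map_units (R n)
      (⟨_, Submonoid.subset_closure ⟨⟨i - 1, by omega⟩, rfl⟩⟩ :
        Submonoid.closure (Set.range fun i : Fin (n - 1) => (1 - X i : QRing n)))
  -- Out of range q_i is 0 by convention; this matters because `FWeight` is defined on all finite
  -- sets.
  · rw [sub_zero, map_one]
    exact isUnit_one

/-- The weights in `R` of the polynomials `F_p^k`. -/
def FWeight (n : ℕ) (I : Finset ℕ) : R n :=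
  ∏ i ∈ I with i + 1 ∉ I, algebraMap (QRing n) (R n) (1 - qv n i)

theorem isUnit_FWeight (n : ℕ) (I : Finset ℕ) : IsUnit (FWeight n I) := by
  rw [FWeight, IsUnit.prod_iff]
  exact fun i _ => isUnit_one_sub_qv n i

theorem toR_F (n k p : ℕ) :
    toR n (F n k p) =
      aeval (fun i => 1 - xv (R n) n i) (wesymm (FWeight n) (Finset.Icc 1 k) p) := by
  rw [toR, F, wesymm, map_sum, map_sum]
  refine Finset.sum_congr rfl fun I _ => ?_
  rw [map_mul, map_mul, map_prod, map_prod, map_prod, mul_comm]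
  congr 1
  · rw [aeval_C, FWeight, map_prod]
    refine Finset.prod_congr rfl fun i _ => ?_
    rw [map_C]
    rfl
  · refine Finset.prod_congr rfl fun i _ => ?_
    rw [aeval_X, map_sub, map_one, map_xv]

theorem span_toR_F (n : ℕ) :
    ∏ i : Fin (n - 1), Submodule.span (R n) (Set.range fun p : Fin ((i : ℕ) + 2) =>
      toR n (F n ((i : ℕ) + 1) p)) = L (R n) n := by
  simp only [toR_F]
  exact span_prod_aeval_wesymm _ map_aeval_one_sub_xv_box _ (isUnit_FWeight n)

/-- Back substitution by induction on the rank r: the diagonal entry a is invertible, so u i is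
recovered from v i and the members of smaller rank. Different r give upper and lower triangular
changes of generators. -/
theorem span_range_eq_of_triangular {A M ι : Type*} [CommRing A] [AddCommGroup M] [Module A M]
    (r : ι → ℕ) (u v : ι → M)
    (h : ∀ i, ∃ a b : A, b * a = 1 ∧ v i - a • u i ∈ Submodule.span A (u '' {j | r j < r i})) :
    Submodule.span A (Set.range v) = Submodule.span A (Set.range u) := by
  refine le_antisymm ?_ ?_
  · rw [Submodule.span_le]
    rintro _ ⟨i, rfl⟩
    obtain ⟨a, b, -, hab⟩ := h i
    rw [← sub_add_cancel (v i) (a • u i)]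
    exact Submodule.add_mem _ (Submodule.span_mono (Set.image_subset_range _ _) hab)
      (Submodule.smul_mem _ _ (Submodule.subset_span ⟨i, rfl⟩))
  · rw [Submodule.span_le]
    rintro _ ⟨i, rfl⟩
    induction hm : r i using Nat.strong_induction_on generalizing i with
    | _ m ih =>
      subst hm
      obtain ⟨a, b, hb, hab⟩ := h i
      have h1 : Submodule.span A (u '' {j | r j < r i}) ≤ Submodule.span A (Set.range v) := by
        rw [Submodule.span_le]
        rintro _ ⟨j, hj, rfl⟩
        exact ih _ hj j rfl
      have h2 : u i = b • (v i - (v i - a • u i)) := by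
        rw [sub_sub_cancel, smul_smul, hb, one_smul]
      rw [h2]
      exact Submodule.smul_mem _ _ (Submodule.sub_mem _ (Submodule.subset_span ⟨i, rfl⟩) (h1 hab))

theorem span_toR_Ehat_eq (n k m : ℕ) :
    Submodule.span (R n) (Set.range fun p : Fin m => toR n (Ehat n k p)) =
      Submodule.span (R n) (Set.range fun p : Fin m => toR n (F n k p)) := by
  refine span_range_eq_of_triangular (A := R n) (fun p : Fin m => (p : ℕ)) _ _ fun p => ⟨(-1) ^ (p : ℕ), (-1) ^ (p : ℕ), ?_, ?_⟩
  · rw [← mul_pow]; simp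
  · have h1 : toR n (Ehat n k p) = ∑ i ∈ Finset.range ((p : ℕ) + 1),
        ((-1) ^ i * ((k - i).choose (p - i) : R n)) • toR n (F n k i) := by
      rw [toR, Ehat, map_sum]
      refine Finset.sum_congr rfl fun i _ => ?_
      rw [smul_eq_C_mul]
      simp [toR]
    rw [h1, Finset.sum_range_succ, Nat.sub_self, Nat.choose_zero_right, Nat.cast_one, mul_one,
      add_sub_cancel_right]
    refine Submodule.sum_mem _ fun i hi => Submodule.smul_mem _ _ (Submodule.subset_span ?_)
    have hi' := Finset.mem_range.1 hi
    exact ⟨⟨i, hi'.trans p.2⟩, hi', rfl⟩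

theorem span_toR_FProd (n : ℕ) :
    Submodule.span (R n) (Set.range fun p : Idx n => toR n (FProd n p)) = L (R n) n := by
  rw [← span_toR_F, prod_span_range]
  simp only [toR, FProd, map_prod]

theorem span_toR_EhatProd (n : ℕ) :
    Submodule.span (R n) (Set.range fun p : Idx n => toR n (EhatProd n p)) = L (R n) n := by
  rw [← span_toR_F]
  simp only [← span_toR_Ehat_eq]
  rw [prod_span_range]
  simp only [toR, EhatProd, map_prod]

/-! ### The products of elementary polynomials and the quantization map -/

/-- The elementary symmetric polynomial `e_p(x_1, …, x_k)` over `A`. -/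
def esym (A : Type) [CommRing A] (n k p : ℕ) : MvPolynomial (Fin n) A :=
  ∑ I ∈ (Finset.Icc 1 k).powersetCard p, ∏ i ∈ I, xv A n i

theorem map_esym {A B : Type} [CommRing A] [CommRing B] (f : A →+* B) (n k p : ℕ) :
    map f (esym A n k p) = esym B n k p := by
  simp only [esym, map_sum, map_prod, map_xv]

theorem isBasisOf_eProd (n : ℕ) : IsBasisOf (eProd n) (L (QRing n) n) := by
  refine isBasisOf_of_span (card_idx n) _ ?_
  have h := span_prod_aeval_wesymm (n := n) (A := QRing n) _ map_aeval_xv_box (fun _ => 1)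
    fun _ => isUnit_one
  rw [prod_span_range] at h
  rw [← h]
  congr 2
  funext p
  refine Finset.prod_congr rfl fun i _ => ?_
  rw [e, wesymm, map_sum]
  refine Finset.sum_congr rfl fun I _ => ?_
  rw [C_1, one_mul, map_prod]
  simp only [aeval_X]

/-- The coefficients picked by choice in the definition are forced, since the e-products are
linearly independent. -/
theorem quantization_sum_eProd (n : ℕ) (c : Idx n → QRing n) :
    quantization n (∑ p, c p • eProd n p) = ∑ p, c p • EhatProd n p := by
  have h : ∃ d : Idx n → QRing n, ∑ p, c p • eProd n p = ∑ p, d p • eProd n p := ⟨c, rfl⟩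
  have hd : h.choose = c := by
    have h1 := h.choose_spec
    have h2 := linearIndependent_iff_injective_fintypeLinearCombination.1 (isBasisOf_eProd n).1
    refine h2 ?_
    rw [Fintype.linearCombination_apply, Fintype.linearCombination_apply]
    exact h1.symm
  rw [quantization, dif_pos h, hd]

theorem exists_eq_sum_eProd {n : ℕ} {f : MvPolynomial (Fin n) (QRing n)}
    (hf : f ∈ L (QRing n) n) : ∃ c : Idx n → QRing n, ∑ p, c p • eProd n p = f := by
  rwa [← (isBasisOf_eProd n).2, Submodule.mem_span_range_iff_exists_fun] at hf

theorem quantization_sum {n : ℕ} {ι : Type*} (s : Finset ι) (m : ι → QRing n)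
    (f : ι → MvPolynomial (Fin n) (QRing n)) (hf : ∀ i, f i ∈ L (QRing n) n) :
    quantization n (∑ i ∈ s, m i • f i) = ∑ i ∈ s, m i • quantization n (f i) := by
  choose c hc using fun i => exists_eq_sum_eProd (hf i)
  have h1 : ∑ i ∈ s, m i • f i = ∑ p, (∑ i ∈ s, m i * c i p) • eProd n p := by
    simp only [← hc, Finset.smul_sum, Finset.sum_smul, smul_smul]
    exact Finset.sum_comm
  rw [h1, quantization_sum_eProd]
  simp only [← hc, quantization_sum_eProd, Finset.smul_sum, Finset.sum_smul, smul_smul]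
  exact Finset.sum_comm

theorem quantization_eProd (n : ℕ) (p : Idx n) : quantization n (eProd n p) = EhatProd n p := by
  have h := quantization_sum_eProd n (Pi.single p 1)
  rw [Finset.sum_eq_single p, Finset.sum_eq_single p] at h
  · simpa using h
  all_goals simp +contextual

theorem e_zero (n k : ℕ) : e n k 0 = 1 := by simp [e]

theorem Ehat_zero (n k : ℕ) : Ehat n k 0 = 1 := by simp [Ehat, F]

/-- The index sequence with entry `j` in position `k` and zero elsewhere. -/
def singleIdx (n : ℕ) (k : Fin (n - 1)) (j : Fin ((k : ℕ) + 2)) : Idx n :=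
  Function.update (fun _ => 0) k j

theorem eProd_singleIdx (n : ℕ) (k : Fin (n - 1)) (j : Fin ((k : ℕ) + 2)) :
    eProd n (singleIdx n k j) = e n ((k : ℕ) + 1) j := by
  rw [eProd, Finset.prod_eq_single k]
  · simp [singleIdx]
  · intro i _ hi
    simp [singleIdx, Function.update_of_ne hi, e_zero]
  · simp

theorem EhatProd_singleIdx (n : ℕ) (k : Fin (n - 1)) (j : Fin ((k : ℕ) + 2)) :
    EhatProd n (singleIdx n k j) = Ehat n ((k : ℕ) + 1) j := by
  rw [EhatProd, Finset.prod_eq_single k]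
  · simp [singleIdx]
  · intro i _ hi
    simp [singleIdx, Function.update_of_ne hi, Ehat_zero]
  · simp

theorem e_mem_L {n : ℕ} (k : Fin (n - 1)) (j : Fin ((k : ℕ) + 2)) :
    e n ((k : ℕ) + 1) j ∈ L (QRing n) n := by
  rw [← eProd_singleIdx, ← (isBasisOf_eProd n).2]
  exact Submodule.subset_span ⟨_, rfl⟩

theorem quantization_e {n : ℕ} (k : Fin (n - 1)) (j : Fin ((k : ℕ) + 2)) :
    quantization n (e n ((k : ℕ) + 1) j) = Ehat n ((k : ℕ) + 1) j := by
  rw [← eProd_singleIdx, quantization_eProd, EhatProd_singleIdx]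

theorem map_mem_span {A B σ : Type*} [CommRing A] [CommRing B] (φ : A →+* B)
    {S : Set (MvPolynomial σ A)} {f : MvPolynomial σ A} (hf : f ∈ Submodule.span A S) :
    map φ f ∈ Submodule.span B (map φ '' S) := by
  induction hf using Submodule.span_induction with
  | mem f hf => exact Submodule.subset_span ⟨f, hf, rfl⟩
  | zero => rw [map_zero]; exact Submodule.zero_mem _
  | add f g _ _ hf hg => rw [map_add]; exact Submodule.add_mem _ hf hg
  | smul a f _ hf =>
    rw [smul_eq_C_mul, map_mul, map_C, ← smul_eq_C_mul]
    exact Submodule.smul_mem _ _ hf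

theorem L_le_span_map {A B : Type} [CommRing A] [CommRing B] (φ : A →+* B) {n : ℕ}
    {S : Set (MvPolynomial (Fin n) A)} (hS : L A n ≤ Submodule.span A S) :
    L B n ≤ Submodule.span B (map φ '' S) := by
  rw [L_eq_box, box_le_iff]
  intro a ha
  have : monomial a (1 : B) = map φ (monomial a 1) := by rw [map_monomial, map_one φ]
  rw [this]
  refine map_mem_span φ (hS ?_)
  rw [L_eq_box]
  exact monomial_mem_box ha 1

theorem map_mem_L {A B : Type} [CommRing A] [CommRing B] (φ : A →+* B) {n : ℕ}
    {f : MvPolynomial (Fin n) A} (hf : f ∈ L A n) : map φ f ∈ L B n := by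
  have h := map_mem_span φ hf
  refine Submodule.span_le.2 ?_ h
  rintro _ ⟨_, ⟨a, ha, rfl⟩, rfl⟩
  rw [map_monomial, map_one]
  exact Submodule.subset_span ⟨a, ha, rfl⟩

/-! ### Isobaric divided differences -/

section Isobaric

variable {n : ℕ}

theorem isobaric_spec (i j : Fin n) (f : MvPolynomial (Fin n) ℤ) :
    (X i - X j) * isobaric i j f = (1 - X j) * f - (1 - X i) * rename (Equiv.swap i j) f := by
  rw [isobaric]
  linear_combination (-(1 - X i)) * divDiff_spec i j f

theorem X_sub_X_ne_zero {i j : Fin n} (h : i ≠ j) :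
    (X i - X j : MvPolynomial (Fin n) ℤ) ≠ 0 :=
  sub_ne_zero.2 fun h' => h (X_injective h')

/-- ℤ[x] is a domain, so the operator is characterized by its defining equation with the denominator
cleared; the operator identities below are verified in this form. -/
theorem isobaric_eq_of_mul_eq {i j : Fin n} (h : i ≠ j) {f g : MvPolynomial (Fin n) ℤ}
    (hg : (X i - X j) * g = (1 - X j) * f - (1 - X i) * rename (Equiv.swap i j) f) :
    isobaric i j f = g :=
  mul_left_cancel₀ (X_sub_X_ne_zero h) ((isobaric_spec i j f).trans hg.symm)

theorem rename_swap_rename_swap (i j : Fin n) (f : MvPolynomial (Fin n) ℤ) :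
    rename (Equiv.swap i j) (rename (Equiv.swap i j) f) = f := by
  rw [rename_rename]
  have : (Equiv.swap i j : Fin n → Fin n) ∘ Equiv.swap i j = id := by
    funext a; simp
  rw [this, rename_id_apply]

theorem isobaric_of_symm {i j : Fin n} (h : i ≠ j) {f : MvPolynomial (Fin n) ℤ}
    (hf : rename (Equiv.swap i j) f = f) : isobaric i j f = f :=
  isobaric_eq_of_mul_eq h (by rw [hf]; ring)

theorem rename_swap_isobaric {i j : Fin n} (h : i ≠ j) (f : MvPolynomial (Fin n) ℤ) :
    rename (Equiv.swap i j) (isobaric i j f) = isobaric i j f := by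
  refine mul_left_cancel₀ (X_sub_X_ne_zero h) ?_
  have h1 := congrArg (rename (Equiv.swap i j)) (isobaric_spec i j f)
  simp only [map_mul, map_sub, map_one, rename_X, Equiv.swap_apply_left, Equiv.swap_apply_right,
    rename_swap_rename_swap] at h1
  linear_combination -h1 - isobaric_spec i j f

theorem isobaric_isobaric {i j : Fin n} (h : i ≠ j) (f : MvPolynomial (Fin n) ℤ) :
    isobaric i j (isobaric i j f) = isobaric i j f :=
  isobaric_of_symm h (rename_swap_isobaric h f)

theorem rename_swap_of_isobaric_eq {i j : Fin n} (h : i ≠ j) {f : MvPolynomial (Fin n) ℤ}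
    (hf : isobaric i j f = f) : rename (Equiv.swap i j) f = f := by
  rw [← hf]; exact rename_swap_isobaric h f

theorem isobaric_add {i j : Fin n} (h : i ≠ j) (f g : MvPolynomial (Fin n) ℤ) :
    isobaric i j (f + g) = isobaric i j f + isobaric i j g :=
  isobaric_eq_of_mul_eq h (by
    rw [map_add]; linear_combination isobaric_spec i j f + isobaric_spec i j g)

theorem isobaric_mul_of_symm {i j : Fin n} (h : i ≠ j) {g : MvPolynomial (Fin n) ℤ}
    (hg : rename (Equiv.swap i j) g = g) (f : MvPolynomial (Fin n) ℤ) :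
    isobaric i j (g * f) = g * isobaric i j f :=
  isobaric_eq_of_mul_eq h (by rw [map_mul, hg]; linear_combination g * isobaric_spec i j f)

/-- The operator `isobaric i j` as a linear map. -/
def isobaricLin {i j : Fin n} (h : i ≠ j) : MvPolynomial (Fin n) ℤ →ₗ[ℤ] MvPolynomial (Fin n) ℤ where
  toFun := isobaric i j
  map_add' := isobaric_add h
  map_smul' a f := by
    rw [smul_eq_C_mul, isobaric_mul_of_symm h (rename_C _ _), smul_eq_C_mul]
    rfl

theorem isobaric_X_left {i j : Fin n} (h : i ≠ j) :
    isobaric i j (X i : MvPolynomial (Fin n) ℤ) = 1 :=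
  isobaric_eq_of_mul_eq h (by rw [rename_X, Equiv.swap_apply_left]; ring)

theorem isobaric_comm {i j k l : Fin n} (hij : i ≠ j) (hkl : k ≠ l) (hik : i ≠ k) (hil : i ≠ l)
    (hjk : j ≠ k) (hjl : j ≠ l) (f : MvPolynomial (Fin n) ℤ) :
    isobaric i j (isobaric k l f) = isobaric k l (isobaric i j f) := by
  have hst : rename (Equiv.swap i j) (rename (Equiv.swap k l) f) =
      rename (Equiv.swap k l) (rename (Equiv.swap i j) f) := by
    rw [rename_rename, rename_rename]
    congr 2
    funext a
    simp only [Function.comp_apply]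
    have := Equiv.Perm.Disjoint.commute (f := Equiv.swap i j) (g := Equiv.swap k l) (by
      intro b
      by_cases hb : b = i ∨ b = j
      · right
        rcases hb with rfl | rfl
        · exact Equiv.swap_apply_of_ne_of_ne hik hil
        · exact Equiv.swap_apply_of_ne_of_ne hjk hjl
      · left
        rw [not_or] at hb
        exact Equiv.swap_apply_of_ne_of_ne hb.1 hb.2)
    exact DFunLike.congr_fun this.eq a
  have e1 := isobaric_spec k l f
  have e2 := isobaric_spec i j (isobaric k l f)
  have e3 := congrArg (rename (Equiv.swap i j)) e1
  have d1 := isobaric_spec i j f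
  have d2 := isobaric_spec k l (isobaric i j f)
  have d3 := congrArg (rename (Equiv.swap k l)) d1
  simp only [map_mul, map_sub, map_one, rename_X, Equiv.swap_apply_of_ne_of_ne hik.symm hjk.symm,
    Equiv.swap_apply_of_ne_of_ne hil.symm hjl.symm] at e3
  simp only [map_mul, map_sub, map_one, rename_X, Equiv.swap_apply_of_ne_of_ne hik hil,
    Equiv.swap_apply_of_ne_of_ne hjk hjl] at d3
  refine mul_left_cancel₀ (mul_ne_zero (X_sub_X_ne_zero hij) (X_sub_X_ne_zero hkl)) ?_
  linear_combination (X k - X l) * e2 + (1 - X j) * e1 - (1 - X i) * e3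
    - (X i - X j) * d2 - (1 - X l) * d1 + (1 - X k) * d3
    + (1 - X i) * (1 - X k) * hst

theorem swap_braid {i j k : Fin n} (hij : i ≠ j) (hik : i ≠ k) (hjk : j ≠ k) :
    Equiv.swap i j * Equiv.swap j k * Equiv.swap i j =
      Equiv.swap j k * Equiv.swap i j * Equiv.swap j k := by
  have h1 : Equiv.swap i j * Equiv.swap j k * Equiv.swap i j = Equiv.swap i k := by
    have := Equiv.swap_mul_swap_mul_swap (x := k) (y := j) (z := i) hjk.symm hik.symm
    rw [Equiv.swap_comm i j, Equiv.swap_comm j k, Equiv.swap_comm i k]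
    rw [Equiv.swap_comm k i]
    simpa [Equiv.swap_comm] using this
  have h2 : Equiv.swap j k * Equiv.swap i j * Equiv.swap j k = Equiv.swap i k := by
    have := Equiv.swap_mul_swap_mul_swap (x := i) (y := j) (z := k) hij hik
    simpa [Equiv.swap_comm] using this
  rw [h1, h2]

/-- After multiplication by (x_i - x_j)(x_i - x_k)(x_j - x_k), both sides become the same
combination of the images of f under the permutations of x_i, x_j, x_k. The only group relation
needed is the braid relation `hsts` on f. -/
theorem isobaric_braid {i j k : Fin n} (hij : i ≠ j) (hik : i ≠ k) (hjk : j ≠ k)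
    (f : MvPolynomial (Fin n) ℤ) :
    isobaric i j (isobaric j k (isobaric i j f)) =
      isobaric j k (isobaric i j (isobaric j k f)) := by
  have hsts : rename (Equiv.swap i j) (rename (Equiv.swap j k) (rename (Equiv.swap i j) f)) =
      rename (Equiv.swap j k) (rename (Equiv.swap i j) (rename (Equiv.swap j k) f)) := by
    simp only [rename_rename]
    congr 2
    funext a
    exact DFunLike.congr_fun (swap_braid hij hik hjk) a
  have e1 := isobaric_spec i j f
  have e2 := isobaric_spec j k (isobaric i j f)
  have e3 := isobaric_spec i j (isobaric j k (isobaric i j f))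
  have e4 := congrArg (rename (Equiv.swap j k)) e1
  have e5 := congrArg (rename (Equiv.swap i j)) e2
  have e6 := congrArg (rename (Equiv.swap i j)) e4
  have d1 := isobaric_spec j k f
  have d2 := isobaric_spec i j (isobaric j k f)
  have d3 := isobaric_spec j k (isobaric i j (isobaric j k f))
  have d4 := congrArg (rename (Equiv.swap i j)) d1
  have d5 := congrArg (rename (Equiv.swap j k)) d2
  have d6 := congrArg (rename (Equiv.swap j k)) d4
  simp only [map_mul, map_sub, map_one, rename_X, Equiv.swap_apply_left, Equiv.swap_apply_right,
    Equiv.swap_apply_of_ne_of_ne hij hik, Equiv.swap_apply_of_ne_of_ne hik.symm hjk.symm,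
    rename_swap_isobaric hij, rename_swap_isobaric hjk] at e4 e5 e6 d4 d5 d6
  refine mul_left_cancel₀ (mul_ne_zero (mul_ne_zero (X_sub_X_ne_zero hij) (X_sub_X_ne_zero hik))
    (X_sub_X_ne_zero hjk)) ?_
  linear_combination (X i - X k) * (X j - X k) * e3 + (1 - X j) * (X i - X k) * e2
    - (1 - X i) * (X j - X k) * e5 + (1 - X k) ^ 2 * e1 - (1 - X j) ^ 2 * e4
    + (1 - X i) ^ 2 * e6
    - ((X i - X j) * (X i - X k) * d3 + (1 - X k) * (X i - X k) * d2
    - (1 - X j) * (X i - X j) * d5 + (1 - X j) * (1 - X k) * d1 - (1 - X i) * (1 - X k) * d4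
    + (1 - X i) * (1 - X j) * d6) - (1 - X i) ^ 2 * (1 - X j) * hsts

end Isobaric

/-! ### Grothendieck polynomials -/

section Grothendieck

variable {n : ℕ}

/-- For overlapping ascents, the hypothesis `IH` expands both sides two steps further, to the two
sides of the braid relation applied to the same 𝔊. -/
theorem isobaric_grothendieck_of_increasing (w : Equiv.Perm (Fin n))
    (IH : ∀ v : Equiv.Perm (Fin n),
      ∑ a : Fin n, (a : ℕ) * (v a : ℕ) < ∑ a : Fin n, (a : ℕ) * (w a : ℕ) →
      ∀ i j : Fin n, (i : ℕ) + 1 = j → v i < v j →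
        grothendieck n v = isobaric i j (grothendieck n (v * Equiv.swap i j)))
    {i j k : Fin n} (hij : (i : ℕ) + 1 = j) (hjk : (j : ℕ) + 1 = k) (h1 : w i < w j)
    (h2 : w j < w k) :
    isobaric i j (grothendieck n (w * Equiv.swap i j)) =
      isobaric j k (grothendieck n (w * Equiv.swap j k)) := by
  have lij : i < j := Fin.lt_def.2 (by omega)
  have ljk : j < k := Fin.lt_def.2 (by omega)
  have lik : i < k := lij.trans ljk
  have nij := lij.ne
  have njk := ljk.ne
  have nik := lik.ne
  have s1 := swap_decreases w i j lij h1
  have t1 := swap_decreases w j k ljk h2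
  have a1 : (w * Equiv.swap i j) j < (w * Equiv.swap i j) k := by
    simp only [Equiv.Perm.mul_apply, Equiv.swap_apply_right,
      Equiv.swap_apply_of_ne_of_ne nik.symm njk.symm]
    exact h1.trans h2
  have s2 := swap_decreases _ j k ljk a1
  have a2 : (w * Equiv.swap i j * Equiv.swap j k) i < (w * Equiv.swap i j * Equiv.swap j k) j := by
    simp only [Equiv.Perm.mul_apply, Equiv.swap_apply_left,
      Equiv.swap_apply_of_ne_of_ne nij nik, Equiv.swap_apply_of_ne_of_ne nik.symm njk.symm]
    exact h2
  have b1 : (w * Equiv.swap j k) i < (w * Equiv.swap j k) j := by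
    simp only [Equiv.Perm.mul_apply, Equiv.swap_apply_left,
      Equiv.swap_apply_of_ne_of_ne nij nik]
    exact h1.trans h2
  have t2 := swap_decreases _ i j lij b1
  have b2 : (w * Equiv.swap j k * Equiv.swap i j) j < (w * Equiv.swap j k * Equiv.swap i j) k := by
    simp only [Equiv.Perm.mul_apply, Equiv.swap_apply_right,
      Equiv.swap_apply_of_ne_of_ne nij nik, Equiv.swap_apply_of_ne_of_ne nik.symm njk.symm]
    exact h1
  rw [IH _ s1 j k hjk a1, IH _ (s2.trans s1) i j hij a2, IH _ t1 i j hij b1,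
    IH _ (t2.trans t1) j k hjk b2, isobaric_braid nij nik njk]
  congr 4
  simp only [mul_assoc]
  congr 1
  simpa only [mul_assoc] using swap_braid nij nik njk

/-- The recursion for Grothendieck polynomials holds for every ascent. -/
theorem grothendieck_eq_isobaric (w : Equiv.Perm (Fin n)) (i j : Fin n) (hij : (i : ℕ) + 1 = j)
    (hw : w i < w j) :
    grothendieck n w = isobaric i j (grothendieck n (w * Equiv.swap i j)) := by
  induction hm : ∑ a : Fin n, (a : ℕ) * (w a : ℕ) using Nat.strong_induction_on
    generalizing w i j with
  | _ m ih =>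
  subst hm
  have IH : ∀ v : Equiv.Perm (Fin n),
      ∑ a : Fin n, (a : ℕ) * (v a : ℕ) < ∑ a : Fin n, (a : ℕ) * (w a : ℕ) →
      ∀ i j : Fin n, (i : ℕ) + 1 = j → v i < v j →
        grothendieck n v = isobaric i j (grothendieck n (v * Equiv.swap i j)) :=
    fun v hv i j hij hw => ih _ hv v i j hij hw rfl
  have h : ∃ a : Fin n × Fin n, (a.1 : ℕ) + 1 = a.2 ∧ w a.1 < w a.2 := ⟨(i, j), hij, hw⟩
  have hunf : grothendieck n w = isobaric h.choose.1 h.choose.2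
      (grothendieck n (w * Equiv.swap h.choose.1 h.choose.2)) := by
    conv_lhs => rw [grothendieck]
    rw [dif_pos h]
  obtain ⟨hkl, hwkl⟩ := h.choose_spec
  rw [hunf]
  generalize h.choose.1 = k at *
  generalize h.choose.2 = l at *
  have lij : i < j := Fin.lt_def.2 (by omega)
  have lkl : k < l := Fin.lt_def.2 (by omega)
  by_cases hik : i = k
  · have hjl : j = l := Fin.ext (by rw [← hij, ← hkl, hik])
    rw [hik, hjl]
  by_cases hjk : j = k
  · subst hjk
    exact (isobaric_grothendieck_of_increasing w IH hij hkl hw hwkl).symm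
  by_cases hil : i = l
  · subst hil
    exact isobaric_grothendieck_of_increasing w IH hkl hij hwkl hw
  have hjl : j ≠ l := fun h => hik (Fin.ext (by have := congrArg Fin.val h; omega))
  have a1 : (w * Equiv.swap k l) i < (w * Equiv.swap k l) j := by
    simpa only [Equiv.Perm.mul_apply, Equiv.swap_apply_of_ne_of_ne hik hil,
      Equiv.swap_apply_of_ne_of_ne hjk hjl] using hw
  have b1 : (w * Equiv.swap i j) k < (w * Equiv.swap i j) l := by
    simpa only [Equiv.Perm.mul_apply, Equiv.swap_apply_of_ne_of_ne (Ne.symm hik) (Ne.symm hjk),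
      Equiv.swap_apply_of_ne_of_ne (Ne.symm hil) (Ne.symm hjl)] using hwkl
  rw [IH _ (swap_decreases w k l lkl hwkl) i j hij a1, IH _ (swap_decreases w i j lij hw) k l hkl b1,
    isobaric_comm lkl.ne lij.ne (Ne.symm hik) (Ne.symm hjk) (Ne.symm hil) (Ne.symm hjl)]
  congr 3
  rw [mul_assoc, mul_assoc]
  congr 1
  refine (Equiv.Perm.Disjoint.commute fun b => ?_).eq
  by_cases hb : b = i ∨ b = j
  · left
    rcases hb with rfl | rfl
    · exact Equiv.swap_apply_of_ne_of_ne hik hil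
    · exact Equiv.swap_apply_of_ne_of_ne hjk hjl
  · right
    rw [not_or] at hb
    exact Equiv.swap_apply_of_ne_of_ne hb.1 hb.2

theorem isobaric_grothendieck_of_ascent (w : Equiv.Perm (Fin n)) {i j : Fin n}
    (hij : (i : ℕ) + 1 = j) (hw : w i < w j) :
    isobaric i j (grothendieck n w) = grothendieck n w := by
  have hne : i ≠ j := fun h => by rw [h] at hij; omega
  rw [grothendieck_eq_isobaric w i j hij hw, isobaric_isobaric hne]

theorem isobaric_grothendieck_of_descent (w : Equiv.Perm (Fin n)) {i j : Fin n}
    (hij : (i : ℕ) + 1 = j) (hw : w j < w i) :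
    isobaric i j (grothendieck n w) = grothendieck n (w * Equiv.swap i j) := by
  rw [grothendieck_eq_isobaric (w * Equiv.swap i j) i j hij (by simpa using hw), mul_assoc,
    Equiv.swap_mul_self, mul_one]

/-- Induction along the recursion defining the Grothendieck polynomials. -/
theorem grothendieck_induction {motive : Equiv.Perm (Fin n) → MvPolynomial (Fin n) ℤ → Prop}
    (top : ∀ w, motive w (∏ j : Fin n, X j ^ (n - ((j : ℕ) + 1))))
    (step : ∀ (w : Equiv.Perm (Fin n)) (i j : Fin n), (i : ℕ) + 1 = j → w i < w j →
      ∀ f, motive (w * Equiv.swap i j) f → motive w (isobaric i j f))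
    (w : Equiv.Perm (Fin n)) : motive w (grothendieck n w) := by
  induction hm : ∑ a : Fin n, (a : ℕ) * (w a : ℕ) using Nat.strong_induction_on
    generalizing w with
  | _ m ih =>
  subst hm
  by_cases h : ∃ a : Fin n × Fin n, (a.1 : ℕ) + 1 = a.2 ∧ w a.1 < w a.2
  · obtain ⟨⟨i, j⟩, hij, hw⟩ := h
    replace hij : (i : ℕ) + 1 = j := hij
    rw [grothendieck_eq_isobaric w i j hij hw]
    exact step w i j hij hw _
      (ih _ (swap_decreases w i j (Fin.lt_def.2 (by omega)) hw) _ rfl)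
  · rw [grothendieck, dif_neg h]
    exact top w

end Grothendieck

/-! ### The Grothendieck polynomials span the staircase module over ℤ -/

section GrothendieckBasis

variable {n : ℕ}

theorem divDiff_eq_of_mul_eq {i j : Fin n} (h : i ≠ j) {f g : MvPolynomial (Fin n) ℤ}
    (hg : (X i - X j) * g = f - rename (Equiv.swap i j) f) : divDiff i j f = g :=
  mul_left_cancel₀ (X_sub_X_ne_zero h) ((divDiff_spec i j f).symm.trans hg.symm)

theorem divDiff_add {i j : Fin n} (h : i ≠ j) (f g : MvPolynomial (Fin n) ℤ) :
    divDiff i j (f + g) = divDiff i j f + divDiff i j g :=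
  divDiff_eq_of_mul_eq h (by
    rw [map_add]; linear_combination -divDiff_spec i j f - divDiff_spec i j g)

theorem divDiff_mul {i j : Fin n} (h : i ≠ j) (f g : MvPolynomial (Fin n) ℤ) :
    divDiff i j (f * g) = divDiff i j f * g + rename (Equiv.swap i j) f * divDiff i j g :=
  divDiff_eq_of_mul_eq h (by
    rw [map_mul]
    linear_combination -g * divDiff_spec i j f -
      rename (Equiv.swap i j) f * divDiff_spec i j g)

/-! #### The order of vanishing at the origin -/

theorem rename_mem_pow_idealOfVars (e : Equiv.Perm (Fin n)) (d : ℕ) {f : MvPolynomial (Fin n) ℤ}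
    (hf : f ∈ idealOfVars (Fin n) ℤ ^ d) : rename e f ∈ idealOfVars (Fin n) ℤ ^ d := by
  have h1 : (idealOfVars (Fin n) ℤ).map (rename e : MvPolynomial (Fin n) ℤ →ₐ[ℤ] _) ≤
      idealOfVars (Fin n) ℤ := by
    rw [idealOfVars, Ideal.map_span, Ideal.span_le]
    rintro _ ⟨_, ⟨k, rfl⟩, rfl⟩
    rw [rename_X]
    exact Ideal.subset_span ⟨e k, rfl⟩
  have h2 := Ideal.mem_map_of_mem (rename e : MvPolynomial (Fin n) ℤ →ₐ[ℤ] _) hf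
  rw [Ideal.map_pow] at h2
  exact Ideal.pow_right_mono h1 d h2

/-- A divided difference lowers the order of vanishing at the origin by at most one, by the twisted
Leibniz rule. -/
theorem divDiff_mem_pow_idealOfVars {i j : Fin n} (h : i ≠ j) (d : ℕ)
    {f : MvPolynomial (Fin n) ℤ} (hf : f ∈ idealOfVars (Fin n) ℤ ^ (d + 1)) :
    divDiff i j f ∈ idealOfVars (Fin n) ℤ ^ d := by
  induction d generalizing f with
  | zero => simp
  | succ d ih =>
    rw [pow_succ] at hf
    induction hf using Submodule.mul_induction_on' with
    | mem_mul_mem a ha b hb =>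
      rw [divDiff_mul h]
      refine Ideal.add_mem _ ?_ (Ideal.mul_mem_right _ _ (rename_mem_pow_idealOfVars _ _ ha))
      rw [pow_succ]
      exact Ideal.mul_mem_mul (ih ha) hb
    | add a _ b _ ha hb =>
      rw [divDiff_add h]
      exact Ideal.add_mem _ ha hb

theorem isobaric_mem_pow_idealOfVars {i j : Fin n} (h : i ≠ j) (d : ℕ)
    {f : MvPolynomial (Fin n) ℤ} (hf : f ∈ idealOfVars (Fin n) ℤ ^ (d + 1)) :
    isobaric i j f ∈ idealOfVars (Fin n) ℤ ^ d :=
  Ideal.add_mem _ (Ideal.pow_le_pow_right (Nat.le_succ d) hf)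
    (Ideal.mul_mem_left _ _ (divDiff_mem_pow_idealOfVars h d hf))

theorem constantCoeff_of_mem_idealOfVars {f : MvPolynomial (Fin n) ℤ}
    (hf : f ∈ idealOfVars (Fin n) ℤ) : constantCoeff f = 0 := by
  have h : idealOfVars (Fin n) ℤ ≤ RingHom.ker (constantCoeff (σ := Fin n) (R := ℤ)) := by
    rw [idealOfVars, Ideal.span_le]
    rintro _ ⟨k, rfl⟩
    simp
  exact h hf

/-! #### The length of a permutation -/

/-- The inversions of a permutation. -/
def invs (w : Equiv.Perm (Fin n)) : Finset (Fin n × Fin n) :=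
  Finset.univ.filter fun a => a.1 < a.2 ∧ w a.2 < w a.1

theorem mem_invs {w : Equiv.Perm (Fin n)} {a b : Fin n} :
    (a, b) ∈ invs w ↔ a < b ∧ w b < w a := by
  rw [invs, Finset.mem_filter]
  exact ⟨fun h => h.2, fun h => ⟨Finset.mem_univ _, h⟩⟩

theorem swap_lt_swap {i j : Fin n} (hij : (i : ℕ) + 1 = j) {a b : Fin n} (hab : a < b)
    (h : ¬ (a = i ∧ b = j)) : Equiv.swap i j a < Equiv.swap i j b := by
  simp only [Equiv.swap_apply_def]
  simp only [Fin.lt_def, Fin.ext_iff] at *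
  split_ifs <;> omega

/-- An adjacent transposition reverses the order of the pair (i, j) and of no other, so applying it
to both positions matches the remaining inversions with those of w. -/
theorem card_invs_mul_swap (w : Equiv.Perm (Fin n)) {i j : Fin n} (hij : (i : ℕ) + 1 = j)
    (hw : w i < w j) : (invs (w * Equiv.swap i j)).card = (invs w).card + 1 := by
  have hlt : i < j := Fin.lt_def.2 (by omega)
  have hmem : (i, j) ∈ invs (w * Equiv.swap i j) := by
    rw [mem_invs]
    simp [hlt, hw]
  have h : (invs (w * Equiv.swap i j)).erase (i, j) =
      (invs w).map ((Equiv.swap i j).prodCongr (Equiv.swap i j)).toEmbedding := by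
    ext ⟨a, b⟩
    rw [Finset.mem_map_equiv, Finset.mem_erase, mem_invs, Equiv.prodCongr_symm,
      Equiv.prodCongr_apply, Prod.map, mem_invs]
    simp only [Equiv.Perm.mul_apply, Equiv.symm_swap, ne_eq, Prod.mk.injEq]
    constructor
    · rintro ⟨h1, h2, h3⟩
      exact ⟨swap_lt_swap hij h2 h1, h3⟩
    · rintro ⟨h1, h2⟩
      refine ⟨?_, ?_, h2⟩
      · rintro ⟨rfl, rfl⟩
        simp only [Equiv.swap_apply_left, Equiv.swap_apply_right] at h1
        exact absurd h1 hlt.asymm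
      · have h3 := swap_lt_swap hij h1 (by
          rintro ⟨h3, h4⟩
          rw [h3, h4] at h2
          exact absurd hw h2.asymm)
        simpa using h3
  rw [← Finset.card_erase_add_one hmem, h, Finset.card_map]

theorem card_invs_le (w : Equiv.Perm (Fin n)) :
    (invs w).card ≤ ∑ j : Fin n, (n - ((j : ℕ) + 1)) := by
  have h : invs w ⊆ ((Finset.univ : Finset (Fin n)).sigma fun a => Finset.Ioi a).map
      (Equiv.sigmaEquivProd (Fin n) (Fin n)).toEmbedding := by
    rintro ⟨a, b⟩ ha
    rw [Finset.mem_map_equiv]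
    simpa using (mem_invs.1 ha).1
  refine (Finset.card_le_card h).trans ?_
  rw [Finset.card_map, Finset.card_sigma]
  refine Finset.sum_le_sum fun a _ => ?_
  rw [Fin.card_Ioi]
  omega

theorem exists_descent {w : Equiv.Perm (Fin n)} (hw : w ≠ 1) :
    ∃ i j : Fin n, (i : ℕ) + 1 = j ∧ w j < w i := by
  by_contra! h
  have h1 : ∀ d : ℕ, ∀ a b : Fin n, (a : ℕ) + d + 1 = b → w a < w b := by
    intro d
    induction d with
    | zero =>
      intro a b hab
      refine (h a b hab).lt_of_ne fun h' => ?_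
      have := w.injective h'
      rw [this] at hab
      omega
    | succ d ih =>
      intro a b hab
      have hb := b.2
      refine (ih a ⟨(a : ℕ) + d + 1, by omega⟩ rfl).trans_le (h _ b ?_)
      change (a : ℕ) + d + 1 + 1 = b
      omega
  have h2 : StrictMono w := fun a b hab => h1 ((b : ℕ) - a - 1) a b (by
    have := Fin.lt_def.1 hab
    omega)
  have h3 : (w : Fin n → Fin n) = id := (h2.range_inj strictMono_id).1 (by
    rw [w.surjective.range_eq, Set.range_id])
  exact hw (Equiv.ext fun a => congrFun h3 a)

theorem grothendieck_mem_pow_idealOfVars (w : Equiv.Perm (Fin n)) :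
    grothendieck n w ∈ idealOfVars (Fin n) ℤ ^ (invs w).card := by
  refine grothendieck_induction
    (motive := fun w f => f ∈ idealOfVars (Fin n) ℤ ^ (invs w).card) ?_ ?_ w
  · intro w
    -- The staircase monomial has the maximal length as its degree, so the bound holds for any w in
    -- this case.
    refine Ideal.pow_le_pow_right (card_invs_le w) ?_
    rw [← Finset.prod_pow_eq_pow_sum]
    exact Ideal.prod_mem_prod fun j _ =>
      Ideal.pow_mem_pow (Ideal.subset_span (Set.mem_range_self j)) _
  · intro w i j hij hw f hf
    rw [card_invs_mul_swap w hij hw] at hf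
    exact isobaric_mem_pow_idealOfVars (fun h => by rw [h] at hij; omega) _ hf

theorem constantCoeff_grothendieck_of_ne_one {w : Equiv.Perm (Fin n)} (hw : w ≠ 1) :
    constantCoeff (grothendieck n w) = 0 := by
  obtain ⟨i, j, hij, h⟩ := exists_descent hw
  have hlt : i < j := Fin.lt_def.2 (by omega)
  have h1 : 1 ≤ (invs w).card := Finset.card_pos.2 ⟨(i, j), mem_invs.2 ⟨hlt, h⟩⟩
  refine constantCoeff_of_mem_idealOfVars ?_
  have h2 := Ideal.pow_le_pow_right h1 (grothendieck_mem_pow_idealOfVars w)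
  rwa [pow_one] at h2

/-! #### Grothendieck polynomials lie in the staircase module -/

theorem mem_L_iff {A : Type} [CommRing A] {f : MvPolynomial (Fin n) A} :
    f ∈ L A n ↔ ∀ k : Fin n, degreeOf k f ≤ n - ((k : ℕ) + 1) := by
  rw [L_eq_box, mem_box_iff]
  simp only [degreeOf_le_iff, mem_support_iff]
  exact ⟨fun h k a ha => h a ha k, fun h a ha k => h k a ha⟩

theorem degreeOf_rename_swap (i j k : Fin n) (f : MvPolynomial (Fin n) ℤ) :
    degreeOf k (rename (Equiv.swap i j) f) = degreeOf (Equiv.swap i j k) f := by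
  have h := degreeOf_rename_of_injective (p := f) (Equiv.swap i j).injective (Equiv.swap i j k)
  rwa [Equiv.swap_apply_self] at h

/-- Degrees in one variable add in a domain, so dividing by x_i - x_j costs one degree in x_i and in
x_j. The spare degree in x_i is what the factor 1 - x_i of the isobaric operator uses up. -/
theorem divDiff_degreeOf_le {i j : Fin n} (hij : (i : ℕ) + 1 = j) {f : MvPolynomial (Fin n) ℤ}
    (hf : f ∈ L ℤ n) (k : Fin n) :
    degreeOf k (divDiff i j f) ≤ if k = i then n - ((k : ℕ) + 2) else n - ((k : ℕ) + 1) := by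
  rw [mem_L_iff] at hf
  have hne : i ≠ j := fun h => by rw [h] at hij; omega
  by_cases h0 : divDiff i j f = 0
  · rw [h0, degreeOf_zero]; exact Nat.zero_le _
  have h1 := congrArg (degreeOf k) (divDiff_spec i j f)
  rw [degreeOf_mul_eq (X_sub_X_ne_zero hne) h0] at h1
  have h2 := degreeOf_sub_le k f (rename (Equiv.swap i j) f)
  rw [degreeOf_rename_swap, h1] at h2
  have hcoeff : ∀ l, l = i ∨ l = j → 1 ≤ degreeOf l (X i - X j : MvPolynomial (Fin n) ℤ) := by
    intro l hl
    have hs : Finsupp.single l 1 ∈ (X i - X j : MvPolynomial (Fin n) ℤ).support := by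
      rw [mem_support_iff, coeff_sub, coeff_X, coeff_X]
      rcases hl with rfl | rfl
      · simp [Finsupp.single_left_inj, hne.symm]
      · simp [Finsupp.single_left_inj, hne]
    have := degreeOf_le_iff.1 (le_refl (degreeOf l (X i - X j : MvPolynomial (Fin n) ℤ))) _ hs
    simpa using this
  have hi := hf i
  have hj := hf j
  have hk := hf k
  by_cases hki : k = i
  · subst hki
    rw [Equiv.swap_apply_left] at h2
    have := hcoeff k (Or.inl rfl)
    rw [if_pos rfl]
    omega
  rw [if_neg hki]
  by_cases hkj : k = j
  · subst hkj
    rw [Equiv.swap_apply_right] at h2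
    have := hcoeff k (Or.inr rfl)
    omega
  · rw [Equiv.swap_apply_of_ne_of_ne hki hkj] at h2
    omega

theorem isobaric_mem_L {i j : Fin n} (hij : (i : ℕ) + 1 = j) {f : MvPolynomial (Fin n) ℤ}
    (hf : f ∈ L ℤ n) : isobaric i j f ∈ L ℤ n := by
  refine Submodule.add_mem _ hf ?_
  rw [mem_L_iff]
  intro k
  have h1 := divDiff_degreeOf_le hij hf k
  have h2 := degreeOf_mul_le k (1 - X i) (divDiff i j f)
  have h3 := degreeOf_sub_le k (1 : MvPolynomial (Fin n) ℤ) (X i)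
  rw [degreeOf_one, degreeOf_X] at h3
  have hj := j.2
  split_ifs at h1 h3 with hki
  · subst hki; omega
  · omega

theorem grothendieck_mem_L (w : Equiv.Perm (Fin n)) : grothendieck n w ∈ L ℤ n := by
  refine grothendieck_induction (motive := fun _ f => f ∈ L ℤ n) ?_ ?_ w
  · intro _
    refine Submodule.subset_span
      ⟨Finsupp.equivFunOnFinite.symm fun j : Fin n => n - ((j : ℕ) + 1), fun j => le_rfl, ?_⟩
    rw [monomial_eq, C_1, one_mul, Finsupp.prod_fintype _ _ (fun _ => pow_zero _)]
    rfl
  · intro w i j hij hw f hf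
    exact isobaric_mem_L hij hf

/-! #### The Grothendieck polynomial of the identity -/

/-- At x = (1, …, 1) the factor 1 - x_i kills the divided difference, so the value of the staircase
monomial persists. -/
theorem eval_one_grothendieck (w : Equiv.Perm (Fin n)) :
    eval (fun _ => 1) (grothendieck n w) = 1 := by
  refine grothendieck_induction (motive := fun _ f => eval (fun _ => 1) f = 1) ?_ ?_ w
  · intro _; simp
  · intro w i j hij hw f hf
    simp [isobaric, hf]

theorem degreeOf_eq_of_rename_swap {i j : Fin n} {f : MvPolynomial (Fin n) ℤ}
    (hf : rename (Equiv.swap i j) f = f) : degreeOf i f = degreeOf j f := by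
  conv_lhs => rw [← hf, degreeOf_rename_swap, Equiv.swap_apply_left]

/-- Every adjacent pair is an ascent of the identity, so 𝔊_1 is symmetric; it does not involve x_n,
hence it is constant, and its value at (1, …, 1) is 1. -/
theorem grothendieck_one (n : ℕ) : grothendieck n 1 = 1 := by
  have hsymm : ∀ i j : Fin n, (i : ℕ) + 1 = j →
      rename (Equiv.swap i j) (grothendieck n 1) = grothendieck n 1 := by
    intro i j hij
    have hlt : i < j := Fin.lt_def.2 (by omega)
    exact rename_swap_of_isobaric_eq hlt.ne
      (isobaric_grothendieck_of_ascent 1 hij (by simpa using hlt))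
  have hdeg : ∀ d : ℕ, ∀ k : Fin n, (k : ℕ) + d + 1 = n → degreeOf k (grothendieck n 1) = 0 := by
    intro d
    induction d with
    | zero =>
      intro k hk
      have := mem_L_iff.1 (grothendieck_mem_L (1 : Equiv.Perm (Fin n))) k
      omega
    | succ d ih =>
      intro k hk
      have h1 : (k : ℕ) + 1 < n := by omega
      rw [degreeOf_eq_of_rename_swap (hsymm k ⟨(k : ℕ) + 1, h1⟩ rfl)]
      exact ih _ (by change (k : ℕ) + 1 + d + 1 = n; omega)
  have hC : grothendieck n 1 = C (coeff 0 (grothendieck n 1)) := by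
    ext a
    rw [coeff_C]
    split_ifs with ha
    · rw [ha]
    · by_contra h
      refine ha ?_
      ext k
      have h1 := degreeOf_le_iff.1 (hdeg (n - 1 - k) k (by omega)).le a (mem_support_iff.2 h)
      exact (Nat.le_zero.1 h1).symm
  have h := eval_one_grothendieck (1 : Equiv.Perm (Fin n))
  rw [hC, eval_C] at h
  rw [hC, h, C_1]

/-! #### The Grothendieck polynomials form a basis -/

/-- For w = 1 take the constant term; otherwise compose the functional of the shorter w s_i with π_i
at a descent of w. At a descent of u, π_i yields 𝔊_{u s_i}. At an ascent it fixes 𝔊_u, and u is too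
long to equal w s_i. -/
theorem exists_dual_grothendieck (w : Equiv.Perm (Fin n)) :
    ∃ ψ : MvPolynomial (Fin n) ℤ →ₗ[ℤ] ℤ, ∀ u : Equiv.Perm (Fin n),
      (invs w).card ≤ (invs u).card → ψ (grothendieck n u) = if u = w then 1 else 0 := by
  induction hm : (invs w).card using Nat.strong_induction_on generalizing w with
  | _ m ih =>
  subst hm
  by_cases hw : w = 1
  · subst hw
    refine ⟨(constantCoeff (σ := Fin n) (R := ℤ)).toIntAlgHom.toLinearMap, fun u _ => ?_⟩
    change constantCoeff (grothendieck n u) = _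
    split_ifs with hu
    · rw [hu, grothendieck_one, map_one]
    · exact constantCoeff_grothendieck_of_ne_one hu
  · obtain ⟨i, j, hij, h⟩ := exists_descent hw
    have hne : i ≠ j := fun h => by rw [h] at hij; omega
    have hcard : ∀ v : Equiv.Perm (Fin n), v j < v i →
        (invs v).card = (invs (v * Equiv.swap i j)).card + 1 := by
      intro v hv
      have := card_invs_mul_swap (v * Equiv.swap i j) hij (by simpa using hv)
      rwa [mul_assoc, Equiv.swap_mul_self, mul_one] at this
    have hwc := hcard w h
    obtain ⟨ψ, hψ⟩ := ih _ (by omega) (w * Equiv.swap i j) rfl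
    refine ⟨ψ ∘ₗ isobaricLin hne, fun u hu => ?_⟩
    change ψ (isobaric i j (grothendieck n u)) = _
    rcases lt_or_ge (u i) (u j) with hu1 | hu1
    · rw [isobaric_grothendieck_of_ascent u hij hu1, hψ u (by omega), if_neg, if_neg]
      · rintro rfl; exact absurd h hu1.asymm
      · rintro rfl; omega
    · have hu2 : u j < u i := hu1.lt_of_ne fun h' => hne (u.injective h').symm
      have huc := hcard u hu2
      rw [isobaric_grothendieck_of_descent u hij hu2, hψ _ (by omega)]
      simp only [mul_left_inj]

theorem span_grothendieck (n : ℕ) :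
    Submodule.span ℤ (Set.range (grothendieck n)) = L ℤ n := by
  refine le_antisymm ?_ ?_
  · rw [Submodule.span_le]
    rintro _ ⟨w, rfl⟩
    exact grothendieck_mem_L w
  choose ψ hψ using exists_dual_grothendieck (n := n)
  set Ψ : MvPolynomial (Fin n) ℤ →ₗ[ℤ] (Equiv.Perm (Fin n) → ℤ) := LinearMap.pi ψ
  have htri : Submodule.span ℤ (Set.range fun w => Ψ (grothendieck n w)) =
      Submodule.span ℤ (Set.range fun w : Equiv.Perm (Fin n) => Pi.single w (1 : ℤ)) := by
    -- The functionals control only permutations at least as long as v, so the off-diagonal entries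
    -- of Ψ(𝔊_w) sit at longer v: the rank must decrease with length.
    refine span_range_eq_of_triangular (A := ℤ)
      (fun w => (∑ j : Fin n, (n - ((j : ℕ) + 1))) - (invs w).card) _ _
      fun w => ⟨1, 1, one_mul 1, ?_⟩
    rw [one_smul]
    obtain ⟨y, hy⟩ : ∃ y : Equiv.Perm (Fin n) → ℤ, y = Ψ (grothendieck n w) - Pi.single w 1 :=
      ⟨_, rfl⟩
    have hyv : ∀ v, y v = ψ v (grothendieck n w) - (Pi.single w 1 : Equiv.Perm (Fin n) → ℤ) v :=
      fun v => by rw [hy]; rfl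
    rw [← hy, pi_eq_sum_univ' y]
    refine Submodule.sum_mem _ fun v _ => ?_
    rcases le_or_gt (invs v).card (invs w).card with hvw | hvw
    · have h3 : y v = 0 := by
        rw [hyv, hψ v w hvw, Pi.single_apply]
        simp [eq_comm]
      rw [h3, zero_smul]
      exact Submodule.zero_mem _
    · refine Submodule.smul_mem _ _ (Submodule.subset_span ⟨v, ?_, rfl⟩)
      have := card_invs_le v
      rw [Set.mem_ofPred_eq]
      omega
  have hsurj : ∀ x : Equiv.Perm (Fin n) → ℤ,
      ∃ f ∈ Submodule.span ℤ (Set.range (grothendieck n)), Ψ f = x := by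
    intro x
    have h1 : x ∈ Submodule.span ℤ (Set.range fun w => Ψ (grothendieck n w)) := by
      rw [htri, pi_eq_sum_univ' x]
      refine Submodule.sum_mem _ fun v _ => Submodule.smul_mem _ _ (Submodule.subset_span ⟨v, rfl⟩)
    have h2 : (Set.range fun w => Ψ (grothendieck n w)) = Ψ '' Set.range (grothendieck n) :=
      Set.range_comp _ _
    rw [h2, ← Submodule.map_span] at h1
    exact h1
  have hle : Submodule.span ℤ (Set.range (grothendieck n)) ≤ L ℤ n := by
    rw [Submodule.span_le]
    rintro _ ⟨w, rfl⟩
    exact grothendieck_mem_L w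
  set b : Module.Basis (Equiv.Perm (Fin n)) ℤ (L ℤ n) :=
    basisL (by rw [Fintype.card_perm, Fintype.card_fin])
  -- Ψ is already onto from the span of the 𝔊_w; being injective on all of `L`, it forces the span
  -- to be everything.
  have hinj : Function.Injective (Ψ ∘ₗ (L ℤ n).subtype ∘ₗ b.equivFun.symm.toLinearMap) := by
    refine OrzechProperty.injective_of_surjective_endomorphism _ fun x => ?_
    obtain ⟨f, hf, hfx⟩ := hsurj x
    exact ⟨b.equivFun ⟨f, hle hf⟩, by simp [hfx]⟩
  intro f hf
  obtain ⟨g, hg, hgf⟩ := hsurj (Ψ f)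
  have h1 : b.equivFun ⟨g, hle hg⟩ = b.equivFun ⟨f, hf⟩ := hinj (by simp [hgf])
  have h2 : g = f := congrArg Subtype.val (b.equivFun.injective h1)
  exact h2 ▸ hg

theorem span_toR_quantumGrothendieck (n : ℕ) :
    Submodule.span (R n) (Set.range fun w : Equiv.Perm (Fin n) =>
      toR n (quantumGrothendieck n w)) = L (R n) n := by
  have hmem : ∀ w : Equiv.Perm (Fin n),
      map (algebraMap ℤ (QRing n)) (grothendieck n w) ∈ L (QRing n) n :=
    fun w => map_mem_L _ (grothendieck_mem_L w)
  refine le_antisymm ?_ ?_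
  · rw [Submodule.span_le]
    rintro _ ⟨w, rfl⟩
    obtain ⟨c, hc⟩ := exists_eq_sum_eProd (hmem w)
    have h : toR n (quantumGrothendieck n w) =
        ∑ p, algebraMap (QRing n) (R n) (c p) • toR n (EhatProd n p) := by
      rw [quantumGrothendieck, ← hc, quantization_sum_eProd, toR, map_sum]
      refine Finset.sum_congr rfl fun p _ => ?_
      rw [smul_eq_C_mul, smul_eq_C_mul, map_mul, map_C, toR]
    change toR n (quantumGrothendieck n w) ∈ L (R n) n
    rw [h, ← span_toR_EhatProd]
    exact Submodule.sum_mem _ fun p _ => Submodule.smul_mem _ _ (Submodule.subset_span ⟨p, rfl⟩)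
  · rw [← span_toR_EhatProd, Submodule.span_le]
    rintro _ ⟨p, rfl⟩
    have h1 : eProd n p ∈ Submodule.span (QRing n)
        (Set.range fun w => map (algebraMap ℤ (QRing n)) (grothendieck n w)) := by
      have h2 := L_le_span_map (algebraMap ℤ (QRing n)) (span_grothendieck n).ge
      rw [← Set.range_comp] at h2
      refine h2 ?_
      rw [← (isBasisOf_eProd n).2]
      exact Submodule.subset_span ⟨p, rfl⟩
    rw [Submodule.mem_span_range_iff_exists_fun] at h1
    obtain ⟨m, hm⟩ := h1
    have h3 : toR n (EhatProd n p) =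
        ∑ w, algebraMap (QRing n) (R n) (m w) • toR n (quantumGrothendieck n w) := by
      rw [← quantization_eProd, ← hm, quantization_sum _ _ _ hmem, toR, map_sum]
      refine Finset.sum_congr rfl fun w _ => ?_
      rw [smul_eq_C_mul, smul_eq_C_mul, map_mul, map_C, toR, quantumGrothendieck]
    change toR n (EhatProd n p) ∈ _
    rw [h3]
    exact Submodule.sum_mem _ fun w _ => Submodule.smul_mem _ _ (Submodule.subset_span ⟨w, rfl⟩)

end GrothendieckBasis

/-! ### Elementary symmetric polynomials and isobaric divided differences -/

section Esym

variable {n : ℕ}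

theorem esym_zero (A : Type) [CommRing A] (n k : ℕ) : esym A n k 0 = 1 := by simp [esym]

theorem esym_of_lt (A : Type) [CommRing A] (n : ℕ) {k j : ℕ} (h : k < j) : esym A n k j = 0 := by
  rw [esym, Finset.powersetCard_eq_empty.2 (by simpa using h), Finset.sum_empty]

theorem esym_succ_succ (A : Type) [CommRing A] (n k j : ℕ) :
    esym A n (k + 1) (j + 1) = esym A n k (j + 1) + xv A n (k + 1) * esym A n k j := by
  have hn : k + 1 ∉ Finset.Icc 1 k := by simp
  have hI : Finset.Icc 1 (k + 1) = insert (k + 1) (Finset.Icc 1 k) := by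
    ext i; simp only [Finset.mem_insert, Finset.mem_Icc]; omega
  have hnot : ∀ I ∈ (Finset.Icc 1 k).powersetCard j, k + 1 ∉ I := fun I hI h =>
    hn ((Finset.mem_powersetCard.1 hI).1 h)
  rw [esym, hI, Finset.powersetCard_succ_insert hn, Finset.sum_union, Finset.sum_image]
  · congr 1
    rw [esym, Finset.mul_sum]
    exact Finset.sum_congr rfl fun I hI => Finset.prod_insert (hnot I hI)
  · intro I hI J hJ h
    rw [← Finset.erase_insert (hnot I hI), h, Finset.erase_insert (hnot J hJ)]
  · rw [Finset.disjoint_left]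
    intro I hI hJ
    obtain ⟨J, -, rfl⟩ := Finset.mem_image.1 hJ
    exact hn ((Finset.mem_powersetCard.1 hI).1 (Finset.mem_insert_self _ _))

theorem xv_succ (A : Type) [CommRing A] (i : Fin n) : xv A n ((i : ℕ) + 1) = X i := by
  rw [xv, dif_pos ⟨by omega, i.2⟩]
  rfl

theorem rename_swap_esym {i j : Fin n} {k : ℕ} (hi : k ≤ i) (hj : k ≤ j) (p : ℕ) :
    rename (Equiv.swap i j) (esym ℤ n k p) = esym ℤ n k p := by
  rw [esym, map_sum]
  refine Finset.sum_congr rfl fun I hI => ?_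
  rw [map_prod]
  refine Finset.prod_congr rfl fun m hm => ?_
  have hm' := Finset.mem_Icc.1 ((Finset.mem_powersetCard.1 hI).1 hm)
  rw [xv]
  split_ifs with h
  · rw [rename_X, Equiv.swap_apply_of_ne_of_ne]
    · exact fun h' => by have := congrArg Fin.val h'; simp only at this; omega
    · exact fun h' => by have := congrArg Fin.val h'; simp only at this; omega
  · exact map_zero _

/-- Write e_{p+1} = e_{p+1}' + x e_p', with x the last variable: the operator fixes the primed
polynomials, is linear over them, and sends x to 1. -/
theorem isobaric_esym {i j : Fin n} (hij : (i : ℕ) + 1 = j) (p : ℕ) :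
    isobaric i j (esym ℤ n ((i : ℕ) + 1) (p + 1)) = esym ℤ n i (p + 1) + esym ℤ n i p := by
  have hne : i ≠ j := fun h => by rw [h] at hij; omega
  have hs : ∀ p, rename (Equiv.swap i j) (esym ℤ n i p) = esym ℤ n i p :=
    rename_swap_esym le_rfl (by omega)
  rw [esym_succ_succ, isobaric_add hne, isobaric_of_symm hne (hs _), mul_comm,
    isobaric_mul_of_symm hne (hs _), xv_succ, isobaric_X_left hne, mul_one]

/-- The combination `∑_{j ≤ k} a_j e_j(x_1, …, x_k)`. -/
def esymComb (n k : ℕ) (a : ℕ → ℤ) : MvPolynomial (Fin n) ℤ :=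
  ∑ j ∈ Finset.range (k + 1), a j • esym ℤ n k j

theorem isobaric_esymComb {i j : Fin n} (hij : (i : ℕ) + 1 = j) (a : ℕ → ℤ) :
    isobaric i j (esymComb n ((i : ℕ) + 1) a) = esymComb n i fun j => a j + a (j + 1) := by
  have hne : i ≠ j := fun h => by rw [h] at hij; omega
  -- Index shift: the top term drops out because e_{i+1} of i variables is 0.
  have h1 : ∑ l ∈ Finset.range ((i : ℕ) + 1), a (l + 1) • esym ℤ n i (l + 1) + a 0 • 1 =
      ∑ l ∈ Finset.range ((i : ℕ) + 1), a l • esym ℤ n i l := by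
    rw [Finset.sum_range_succ, esym_of_lt ℤ n (Nat.lt_succ_self _), smul_zero, add_zero,
      Finset.sum_range_succ' (fun l => a l • esym ℤ n i l), esym_zero]
  have h2 : isobaricLin hne (1 : MvPolynomial (Fin n) ℤ) = 1 :=
    isobaric_of_symm hne (map_one _)
  change isobaricLin hne _ = _
  rw [esymComb, Finset.sum_range_succ', map_add, map_sum, esym_zero, map_smul, h2]
  simp only [map_smul]
  have h3 : ∀ l, isobaricLin hne (esym ℤ n ((i : ℕ) + 1) (l + 1)) =
      esym ℤ n i (l + 1) + esym ℤ n i l := isobaric_esym hij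
  simp only [h3, smul_add, Finset.sum_add_distrib, esymComb, add_smul]
  rw [← h1]
  abel

theorem constantCoeff_esymComb (n k : ℕ) (a : ℕ → ℤ) : constantCoeff (esymComb n k a) = a 0 := by
  have h : ∀ j, constantCoeff (esym ℤ n k (j + 1)) = 0 := by
    intro j
    rw [esym, map_sum]
    refine Finset.sum_eq_zero fun I hI => ?_
    have hI' := (Finset.mem_powersetCard.1 hI).2
    obtain ⟨i, hi⟩ := Finset.card_pos.1 (by omega : 0 < I.card)
    rw [map_prod]
    refine Finset.prod_eq_zero hi ?_
    rw [xv]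
    split_ifs
    · exact constantCoeff_X _ _
    · exact map_zero _
  rw [esymComb, Finset.sum_range_succ', map_add, map_sum, esym_zero]
  simp [h]

theorem esym_eq_sum_fin {k : ℕ} (hk : k ≤ n) (p : ℕ) :
    esym ℤ n k p = ∑ I ∈ ((Finset.univ : Finset (Fin n)).filter (fun i : Fin n => (i : ℕ) < k)).powersetCard p,
      ∏ i ∈ I, X i := by
  have hinj : Function.Injective fun i : Fin n => (i : ℕ) + 1 := fun i j h => by
    have : (i : ℕ) + 1 = j + 1 := h
    exact Fin.ext (by omega)
  have h : Finset.Icc 1 k = ((Finset.univ : Finset (Fin n)).filter (fun i : Fin n => (i : ℕ) < k)).map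
      ⟨fun i : Fin n => (i : ℕ) + 1, hinj⟩ := by
    ext m
    simp only [Finset.mem_Icc, Finset.mem_map, Finset.mem_filter, Finset.mem_univ, true_and,
      Function.Embedding.coeFn_mk]
    constructor
    · intro hm
      exact ⟨⟨m - 1, by omega⟩, by simp only; omega, by simp only; omega⟩
    · rintro ⟨i, hi, rfl⟩
      omega
  rw [esym, h, Finset.powersetCard_map, Finset.sum_map]
  refine Finset.sum_congr rfl fun I _ => ?_
  rw [RelEmbedding.coe_toEmbedding, Finset.mapEmbedding_apply, Finset.prod_map]
  exact Finset.prod_congr rfl fun i _ => xv_succ ℤ i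

/-- The exponent vector of the square-free monomial with support `I`. -/
def indFinsupp (I : Finset (Fin n)) : Fin n →₀ ℕ := Finsupp.equivFunOnFinite.symm (ind I)

theorem indFinsupp_apply (I : Finset (Fin n)) (i : Fin n) :
    indFinsupp I i = if i ∈ I then 1 else 0 := rfl

theorem indFinsupp_injective : Function.Injective (indFinsupp (n := n)) := by
  intro I J h
  ext i
  have := DFunLike.congr_fun h i
  rw [indFinsupp_apply, indFinsupp_apply] at this
  by_cases h1 : i ∈ I <;> by_cases h2 : i ∈ J <;> simp_all

theorem monomial_indFinsupp (I : Finset (Fin n)) (c : ℤ) :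
    monomial (indFinsupp I) c = c • ∏ i ∈ I, X i := by
  rw [monomial_eq, smul_eq_C_mul, Finsupp.prod_fintype _ _ (fun _ => pow_zero _)]
  congr 1
  simp only [indFinsupp_apply, pow_ite, pow_one, pow_zero]
  rw [Finset.prod_ite_mem, Finset.univ_inter]

theorem mapDomain_indFinsupp (e : Equiv.Perm (Fin n)) (I : Finset (Fin n)) :
    (indFinsupp I).mapDomain e = indFinsupp (I.map e.toEmbedding) := by
  ext i
  have h := Finsupp.mapDomain_apply e.injective (indFinsupp I) (e.symm i)
  rw [Equiv.apply_symm_apply] at h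
  rw [h, indFinsupp_apply, indFinsupp_apply]
  simp only [Finset.mem_map_equiv]

/-- The coefficients of the square-free monomials in a polynomial symmetric in the first `k`
variables depend only on the degree. -/
theorem coeff_indFinsupp_eq {k : ℕ} {f : MvPolynomial (Fin n) ℤ}
    (hf : ∀ i j : Fin n, (i : ℕ) + 1 = j → (j : ℕ) < k → rename (Equiv.swap i j) f = f)
    (I : Finset (Fin n)) (hI : ∀ i ∈ I, (i : ℕ) < k) :
    coeff (indFinsupp I) f =
      coeff (indFinsupp (Finset.univ.filter fun i : Fin n => (i : ℕ) < I.card)) f := by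
  induction hm : ∑ i ∈ I, (i : ℕ) using Nat.strong_induction_on generalizing I with
  | _ m ih =>
  subst hm
  -- Such a gap is closed by a transposition fixing f, which lowers the sum of the elements of I.
  -- Without gaps, I is an initial segment.
  by_cases h : ∃ i j : Fin n, (i : ℕ) + 1 = j ∧ i ∉ I ∧ j ∈ I
  · obtain ⟨i, j, hij, hi, hj⟩ := h
    have hmap : I.map (Equiv.swap i j).toEmbedding = insert i (I.erase j) := by
      ext a
      rw [Finset.mem_map_equiv, Equiv.symm_swap, Finset.mem_insert, Finset.mem_erase]
      by_cases hai : a = i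
      · subst hai; simp [hj]
      by_cases haj : a = j
      · subst haj; simp [hi, hai]
      · rw [Equiv.swap_apply_of_ne_of_ne hai haj]; simp [hai, haj]
    have hcoeff : coeff (indFinsupp I) f =
        coeff (indFinsupp (I.map (Equiv.swap i j).toEmbedding)) f := by
      rw [← mapDomain_indFinsupp]
      conv_rhs => rw [← hf i j hij (hI j hj)]
      exact (coeff_rename_mapDomain _ (Equiv.swap i j).injective _ _).symm
    have hni : i ∉ I.erase j := fun h => hi (Finset.mem_of_mem_erase h)
    have hsum : ∑ a ∈ I.map (Equiv.swap i j).toEmbedding, (a : ℕ) < ∑ a ∈ I, (a : ℕ) := by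
      rw [hmap, Finset.sum_insert hni, ← Finset.add_sum_erase I _ hj]
      omega
    rw [hcoeff, ih _ hsum _ _ rfl, Finset.card_map]
    intro a ha
    rw [hmap, Finset.mem_insert] at ha
    rcases ha with rfl | ha
    · have := hI j hj; omega
    · exact hI a (Finset.mem_of_mem_erase ha)
  · push Not at h
    have hdown : ∀ d : ℕ, ∀ i j : Fin n, (i : ℕ) + d = j → j ∈ I → i ∈ I := by
      intro d
      induction d with
      | zero => intro i j hij hj; rwa [Fin.ext hij]
      | succ d ih' =>
        intro i j hij hj
        by_contra hi
        have hj2 := j.2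
        exact h i ⟨(i : ℕ) + 1, by omega⟩ rfl hi
          (ih' _ j (by change (i : ℕ) + 1 + d = j; omega) hj)
    have hsub : I ⊆ Finset.univ.filter fun i : Fin n => (i : ℕ) < I.card := by
      intro j hj
      rw [Finset.mem_filter]
      refine ⟨Finset.mem_univ _, ?_⟩
      have h1 : Finset.Iic j ⊆ I := fun i hi =>
        hdown ((j : ℕ) - i) i j (by have := Fin.le_def.1 (Finset.mem_Iic.1 hi); omega) hj
      have h2 := Finset.card_le_card h1
      rw [Fin.card_Iic] at h2
      omega
    have hcard : (Finset.univ.filter fun i : Fin n => (i : ℕ) < I.card).card ≤ I.card := by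
      rw [Fin.card_filter_val_lt]
      exact min_le_right _ _
    rw [← Finset.eq_of_subset_of_card_le hsub hcard]

/-- A polynomial that is symmetric in the first `k` variables, of degree at most one in each of
them, and free of the others is a combination of elementary symmetric polynomials. -/
theorem exists_eq_esymComb {k : ℕ} (hk : k ≤ n) {f : MvPolynomial (Fin n) ℤ}
    (hf : ∀ i j : Fin n, (i : ℕ) + 1 = j → (j : ℕ) < k → rename (Equiv.swap i j) f = f)
    (hdeg : ∀ i, degreeOf i f ≤ if (i : ℕ) < k then 1 else 0) :
    ∃ a, f = esymComb n k a := by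
  set s := (Finset.univ : Finset (Fin n)).filter (fun i : Fin n => (i : ℕ) < k) with hs
  have hcard : s.card = k := by rw [hs, Fin.card_filter_val_lt, min_eq_right hk]
  have hsupp : f.support ⊆ s.powerset.image indFinsupp := by
    intro b hb
    rw [Finset.mem_image]
    refine ⟨b.support, ?_, ?_⟩
    · rw [Finset.mem_powerset]
      intro i hi
      rw [hs, Finset.mem_filter]
      refine ⟨Finset.mem_univ _, ?_⟩
      have h1 := degreeOf_le_iff.1 (hdeg i) b hb
      have h2 := Finsupp.mem_support_iff.1 hi
      split_ifs at h1 with h3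
      · exact h3
      · omega
    · ext i
      have h1 := degreeOf_le_iff.1 (hdeg i) b hb
      have h2 := Finsupp.mem_support_iff (f := b) (a := i)
      rw [indFinsupp_apply]
      have h3 : b i ≤ 1 := h1.trans (by split_ifs <;> omega)
      split_ifs with h4
      · have := h2.1 h4; omega
      · exact (not_not.1 (mt h2.2 h4)).symm
  refine ⟨fun j => coeff (indFinsupp (Finset.univ.filter fun i : Fin n => (i : ℕ) < j)) f, ?_⟩
  have h1 : f = ∑ I ∈ s.powerset, monomial (indFinsupp I) (coeff (indFinsupp I) f) := by
    conv_lhs => rw [← support_sum_monomial_coeff f]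
    rw [Finset.sum_subset hsupp, Finset.sum_image fun I _ J _ h => indFinsupp_injective h]
    intro b _ hb
    rw [notMem_support_iff.1 hb, monomial_zero]
  conv_lhs => rw [h1]
  rw [Finset.sum_powerset, hcard, esymComb]
  refine Finset.sum_congr rfl fun j _ => ?_
  rw [esym_eq_sum_fin hk, Finset.smul_sum]
  refine Finset.sum_congr rfl fun I hI => ?_
  obtain ⟨hI1, hI2⟩ := Finset.mem_powersetCard.1 hI
  rw [coeff_indFinsupp_eq hf I fun i hi => (Finset.mem_filter.1 (hI1 hi)).2, hI2,
    monomial_indFinsupp]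

end Esym

/-! ### The cycles `c[k, p]` -/

section Cycle

variable {n : ℕ}

/-- The cycle `(k - p, …, k)` in the zero-based numbering. -/
def cyc (n k p : ℕ) (hk : k < n) : Equiv.Perm (Fin n) :=
  Fin.cycleIcc ⟨k - p, by omega⟩ ⟨k, hk⟩

theorem cyc_val {k p : ℕ} (hk : k < n) (a : Fin n) :
    (cyc n k p hk a : ℕ) =
      if k - p ≤ a ∧ (a : ℕ) < k then (a : ℕ) + 1 else if (a : ℕ) = k then k - p else a := by
  have : NeZero n := ⟨by omega⟩
  have hle : (⟨k - p, by omega⟩ : Fin n) ≤ ⟨k, hk⟩ := Fin.le_def.2 (Nat.sub_le _ _)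
  rw [cyc]
  split_ifs with h1 h2
  · rw [Fin.cycleIcc_of_ge_of_lt (Fin.le_def.2 h1.1) (Fin.lt_def.2 h1.2)]
    rw [Fin.val_add_one_of_lt' (by omega)]
  · have : a = ⟨k, hk⟩ := Fin.ext h2
    rw [this, Fin.cycleIcc_of_last hle]
  · rw [not_and_or] at h1
    by_cases h3 : (a : ℕ) < k - p
    · rw [Fin.cycleIcc_of_lt (Fin.lt_def.2 h3)]
    · rw [Fin.cycleIcc_of_gt (Fin.lt_def.2 (by simp only; omega))]

theorem cyc_zero {k : ℕ} (hk : k < n) : cyc n k 0 hk = 1 := by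
  ext a
  rw [cyc_val]
  simp only [Equiv.Perm.one_apply]
  split_ifs <;> omega

theorem cyc_ne_one {k p : ℕ} (hk : k < n) (hp : 1 ≤ p) (hpk : p ≤ k) : cyc n k p hk ≠ 1 := by
  intro h
  have h1 := cyc_val (p := p) hk ⟨k, hk⟩
  rw [h] at h1
  simp at h1
  omega

theorem cyc_ascent {k p : ℕ} (hk : k < n) {i j : Fin n} (hij : (i : ℕ) + 1 = j)
    (hj : (j : ℕ) ≠ k) : cyc n k p hk i < cyc n k p hk j := by
  rw [Fin.lt_def, cyc_val, cyc_val]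
  split_ifs <;> omega

theorem cyc_descent {k p : ℕ} (hk : k + 1 < n) (hpk : p ≤ k) :
    cyc n (k + 1) (p + 1) hk ⟨k + 1, hk⟩ < cyc n (k + 1) (p + 1) hk ⟨k, by omega⟩ := by
  rw [Fin.lt_def, cyc_val, cyc_val]
  simp only
  split_ifs <;> omega

theorem cyc_mul_swap {k p : ℕ} (hk : k + 1 < n) (hpk : p ≤ k) :
    cyc n (k + 1) (p + 1) hk * Equiv.swap ⟨k, by omega⟩ ⟨k + 1, hk⟩ = cyc n k p (by omega) := by
  ext a
  rw [Equiv.Perm.mul_apply, cyc_val, cyc_val]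
  by_cases h1 : a = ⟨k, by omega⟩
  · subst h1
    rw [Equiv.swap_apply_left]
    simp
  by_cases h2 : a = ⟨k + 1, hk⟩
  · subst h2
    rw [Equiv.swap_apply_right]
    simp only
    split_ifs <;> omega
  · rw [Equiv.swap_apply_of_ne_of_ne h1 h2]
    simp only [Fin.ext_iff] at h1 h2
    split_ifs <;> omega

theorem isobaric_grothendieck_cyc {k p : ℕ} (hk : k + 1 < n) (hpk : p ≤ k) :
    isobaric ⟨k, by omega⟩ ⟨k + 1, hk⟩ (grothendieck n (cyc n (k + 1) (p + 1) hk)) =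
      grothendieck n (cyc n k p (by omega)) := by
  rw [isobaric_grothendieck_of_descent _ rfl (cyc_descent hk hpk), cyc_mul_swap hk hpk]

/-- The only possible descent of the cycle is at its last position, so 𝔊 is symmetric in x_1, …,
x_{n-1}. The staircase bounds the degree in x_{n-1} by 1, symmetry spreads this bound, and x_n is
absent. -/
theorem exists_grothendieck_cyc_last {k : ℕ} (hk : k + 1 = n) (p : ℕ) :
    ∃ a, grothendieck n (cyc n k p (by omega)) = esymComb n k a := by
  set g := grothendieck n (cyc n k p (by omega)) with hg
  have hsymm : ∀ i j : Fin n, (i : ℕ) + 1 = j → (j : ℕ) < k →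
      rename (Equiv.swap i j) g = g := by
    intro i j hij hj
    have hlt : i < j := Fin.lt_def.2 (by omega)
    exact rename_swap_of_isobaric_eq hlt.ne
      (isobaric_grothendieck_of_ascent _ hij (cyc_ascent _ hij hj.ne))
  have hL := mem_L_iff.1 (grothendieck_mem_L (cyc n k p (by omega)))
  refine exists_eq_esymComb (by omega) hsymm fun i => ?_
  have hdeg : ∀ d : ℕ, ∀ i : Fin n, (i : ℕ) + d + 1 = k → degreeOf i g ≤ 1 := by
    intro d
    induction d with
    | zero =>
      intro i hi
      have := hL i
      rw [← hg] at this
      omega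
    | succ d ih =>
      intro i hi
      have h1 : (i : ℕ) + 1 < n := by omega
      rw [degreeOf_eq_of_rename_swap (hsymm i ⟨(i : ℕ) + 1, h1⟩ rfl (by simp only; omega))]
      exact ih _ (by simp only; omega)
  split_ifs with hi
  · exact hdeg (k - 1 - i) i (by omega)
  · have := hL i
    rw [← hg] at this
    omega

/-- Descend from k = n - 1: the isobaric operator takes c[k+1, p+1] to c[k, p] and combinations of
level k + 1 to combinations of level k. -/
theorem exists_grothendieck_cyc {k p : ℕ} (hk : k < n) (hpk : p ≤ k) :
    ∃ a, grothendieck n (cyc n k p hk) = esymComb n k a := by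
  induction hd : n - (k + 1) generalizing k p with
  | zero => exact exists_grothendieck_cyc_last (by omega) p
  | succ d ih =>
    have hk1 : k + 1 < n := by omega
    obtain ⟨a, ha⟩ := ih hk1 (Nat.succ_le_succ hpk) (by omega)
    refine ⟨fun j => a j + a (j + 1), ?_⟩
    rw [← isobaric_grothendieck_cyc hk1 hpk, ha]
    exact isobaric_esymComb rfl a

/-- The sums a_j + a_{j+1} are the coefficients for c[k-1, p-1], known by induction, and the
constant term gives a_0 = 0 for p ≥ 1; together these determine a_0, …, a_p. -/
theorem esymComb_cyc_coeff {k p : ℕ} (hk : k < n) (hpk : p ≤ k) {a : ℕ → ℤ}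
    (ha : grothendieck n (cyc n k p hk) = esymComb n k a) :
    (∀ j < p, a j = 0) ∧ a p = 1 := by
  have h0 := congrArg constantCoeff ha
  rw [constantCoeff_esymComb] at h0
  induction p generalizing k a with
  | zero =>
    rw [cyc_zero, grothendieck_one, map_one] at h0
    exact ⟨fun j hj => absurd hj (Nat.not_lt_zero j), h0.symm⟩
  | succ p ih =>
    rw [constantCoeff_grothendieck_of_ne_one (cyc_ne_one hk (by omega) hpk)] at h0
    obtain ⟨k, rfl⟩ : ∃ l, k = l + 1 := ⟨k - 1, by omega⟩
    have h1 : grothendieck n (cyc n k p (by omega)) = esymComb n k fun j => a j + a (j + 1) := by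
      rw [← isobaric_grothendieck_cyc hk (by omega), ha]
      exact isobaric_esymComb rfl a
    obtain ⟨h2, h3⟩ := ih (by omega) (by omega) h1 (by rw [h1, constantCoeff_esymComb])
    have h4 : ∀ j < p + 1, a j = 0 := by
      intro j
      induction j with
      | zero => intro _; exact h0.symm
      | succ j ihj =>
        intro hj
        have h5 := h2 j (by omega)
        have h6 := ihj (by omega)
        omega
    refine ⟨h4, ?_⟩
    have := h4 p (by omega)
    omega

theorem quantumGrothendieck_cyc (i : Fin (n - 1)) {p : ℕ} {a : ℕ → ℤ}
    (ha : grothendieck n (cyc n ((i : ℕ) + 1) p (by omega)) = esymComb n ((i : ℕ) + 1) a) :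
    quantumGrothendieck n (cyc n ((i : ℕ) + 1) p (by omega)) =
      ∑ j : Fin ((i : ℕ) + 2), (a j : QRing n) • Ehat n ((i : ℕ) + 1) j := by
  have h : map (algebraMap ℤ (QRing n)) (esymComb n ((i : ℕ) + 1) a) =
      ∑ j : Fin ((i : ℕ) + 2), (a j : QRing n) • e n ((i : ℕ) + 1) j := by
    rw [esymComb, Finset.sum_range, map_sum]
    refine Finset.sum_congr rfl fun j _ => ?_
    rw [smul_eq_C_mul, smul_eq_C_mul, map_mul, map_C, map_esym]
    simp only [eq_intCast]
    rfl
  rw [quantumGrothendieck, ha, h, quantization_sum _ _ _ (e_mem_L i)]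
  exact Finset.sum_congr rfl fun j _ => by rw [quantization_e]

theorem span_toR_G_eq (i : Fin (n - 1)) :
    Submodule.span (R n) (Set.range fun p : Fin ((i : ℕ) + 2) =>
        toR n (G n ((i : ℕ) + 1) p (by omega))) =
      Submodule.span (R n) (Set.range fun p : Fin ((i : ℕ) + 2) =>
        toR n (Ehat n ((i : ℕ) + 1) p)) := by
  -- The corrections involve Ê_j with j > p, so the rank reverses the order of p.
  refine span_range_eq_of_triangular (A := R n) (fun p : Fin ((i : ℕ) + 2) => (i : ℕ) + 1 - p) _ _
    fun p => ⟨1, 1, one_mul 1, ?_⟩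
  rw [one_smul]
  have hp := p.2
  by_cases h0 : (p : ℕ) = 0
  · rw [G, if_pos h0, h0, Ehat_zero, sub_self]
    exact Submodule.zero_mem _
  obtain ⟨a, ha⟩ := exists_grothendieck_cyc (n := n) (k := (i : ℕ) + 1) (p := p) (by omega)
    (by omega)
  obtain ⟨h1, h2⟩ := esymComb_cyc_coeff _ (by omega) ha
  have h3 : toR n (G n ((i : ℕ) + 1) p (by omega)) =
      ∑ j : Fin ((i : ℕ) + 2), (a j : R n) • toR n (Ehat n ((i : ℕ) + 1) j) := by
    have := quantumGrothendieck_cyc i ha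
    rw [cyc] at this
    rw [G, if_neg h0, this, toR, map_sum]
    refine Finset.sum_congr rfl fun j _ => ?_
    rw [smul_eq_C_mul, smul_eq_C_mul, map_mul, map_C, toR, map_intCast]
  rw [h3, ← Finset.add_sum_erase _ _ (Finset.mem_univ p), h2, Int.cast_one, one_smul,
    add_sub_cancel_left]
  refine Submodule.sum_mem _ fun j hj => ?_
  rcases lt_or_ge (j : ℕ) p with hjp | hjp
  · rw [h1 j hjp, Int.cast_zero, zero_smul]
    exact Submodule.zero_mem _
  · refine Submodule.smul_mem _ _ (Submodule.subset_span ⟨j, ?_, rfl⟩)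
    have hne : (j : ℕ) ≠ p := fun h => (Finset.mem_erase.1 hj).1 (Fin.ext h)
    rw [Set.mem_ofPred_eq]
    omega

theorem span_toR_GProd (n : ℕ) :
    Submodule.span (R n) (Set.range fun p : Idx n => toR n (GProd n p)) = L (R n) n := by
  rw [← span_toR_F]
  simp only [← span_toR_Ehat_eq, ← span_toR_G_eq]
  rw [prod_span_range]
  simp only [toR, GProd, map_prod]

end Cycle

end

end QGroth

/-! ### The four bases -/

theorem mainTheorem8 (n : ℕ) :
    QGroth.IsBasisOf (fun p : QGroth.Idx n => QGroth.toR n (QGroth.FProd n p))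
        (QGroth.L (QGroth.R n) n) ∧
      QGroth.IsBasisOf
        (fun w : Equiv.Perm (Fin n) => QGroth.toR n (QGroth.quantumGrothendieck n w))
        (QGroth.L (QGroth.R n) n) ∧
      QGroth.IsBasisOf (fun p : QGroth.Idx n => QGroth.toR n (QGroth.EhatProd n p))
        (QGroth.L (QGroth.R n) n) ∧
      QGroth.IsBasisOf (fun p : QGroth.Idx n => QGroth.toR n (QGroth.GProd n p))
        (QGroth.L (QGroth.R n) n) :=
  ⟨QGroth.isBasisOf_of_span (QGroth.card_idx n) _ (QGroth.span_toR_FProd n),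
    QGroth.isBasisOf_of_span (by rw [Fintype.card_perm, Fintype.card_fin]) _
      (QGroth.span_toR_quantumGrothendieck n),
    QGroth.isBasisOf_of_span (QGroth.card_idx n) _ (QGroth.span_toR_EhatProd n),
    QGroth.isBasisOf_of_span (QGroth.card_idx n) _ (QGroth.span_toR_GProd n)⟩
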